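/- Let $\mathbb D=\{z\in\mathbb C:|z|<1\}$. Let $\mathcal S_H^0$ be the class of all univalent (injective) complex-valued harmonic mappings $f=h+\overline g$ of $\mathbb D$, where $$h(z)=z+\sum_{n\ge 2}a_nz^n,\qquad g(z)=\sum_{n\ge 1}b_nz^n$$ are analytic in $\mathbb D$, such that $f$ is sense-preserving, i.e. $|h'(z)|^2-|g'(z)|^2>0$ for all $z\in\mathbb D$, and $f_{\bar z}(0)=0$, i.e. $b_1=0$. Say that $f$ has half-integer coefficients if all the Taylor coefficients $a_n$ of $h$ and $b_n$ of $g$ lie in $\tfrac12\mathbb Z$ (integers being allowed), and that $f$ is convex in the imaginary direction if every line parallel to the imaginary axis has a connected (possibly empty) intersection with $f(\mathbb D)$. **Theorem.** Let $f\in\mathcal S_H^0$ have half-integer coefficients. If $f$ is convex in the imaginary direction, then $f$ is, on $\mathbb D$, one of the eleven functions in $\mathcal T_5\cup\mathcal T_6$, where $$\mathcal T_5=\left\{z,\ \frac{z}{1\pm z},\ \frac{z}{1-z^2},\ \frac{z(2\pm z)}{2(1\pm z)},\ \frac{z(2-z^2)}{2(1-z^2)},\ \frac{z(2\pm z)}{2(1-z^2)}\right\}$$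 (nine functions; in $\frac{z(2\pm z)}{2(1\pm z)}$ the two signs agree) and $$\mathcal T_6=\left\{\operatorname{Re}\Big(\frac{z}{1-z}\Big)+i\operatorname{Im}\Big(\frac{z}{(1-z)^2}\Big),\ \operatorname{Re}\Big(\frac{z}{1+z}\Big)+i\operatorname{Im}\Big(\frac{z}{(1+z)^2}\Big)\right\}.$$ -/

import Mathlib

noncomputable section

namespace UnivalentHarmonic

/-- The open unit disk. -/
def unitDisk : Set ℂ := Metric.ball 0 1

/-- `f = h + conj g` on the unit disk with `h` (the analytic part) and `g` (the co-analytic part)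
analytic in the disk. The normalization `g 0 = 0` makes the decomposition unique on the disk. -/
structure IsCanonicalDecomposition (f h g : ℂ → ℂ) : Prop where
  analytic_h : DifferentiableOn ℂ h unitDisk
  analytic_g : DifferentiableOn ℂ g unitDisk
  g_zero : g 0 = 0
  eq_add_conj : ∀ z ∈ unitDisk, f z = h z + (starRingEnd ℂ) (g z)

/-- The class `S_H`: univalent sense-preserving harmonic mappings `f = h + conj g` of the unit disk
with `h(z) = z + ∑_{n ≥ 2} a_n z^n` and `g(z) = ∑_{n ≥ 1} b_n z^n`. Sense-preserving means that the
Jacobian `|h'|^2 - |g'|^2` is positive in the disk. -/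
def classSH : Set (ℂ → ℂ) :=
  {f | InnerProductSpace.HarmonicOnNhd f unitDisk ∧ Set.InjOn f unitDisk ∧
    ∃ h g : ℂ → ℂ, IsCanonicalDecomposition f h g ∧ h 0 = 0 ∧ deriv h 0 = 1 ∧
      ∀ z ∈ unitDisk, 0 < ‖deriv h z‖ ^ 2 - ‖deriv g z‖ ^ 2}

/-- The class `S_H^0`: the `f = h + conj g` in `S_H` whose `conj z`-derivative at the origin,
`conj (g'(0))`, vanishes. -/
def classSH0 : Set (ℂ → ℂ) :=
  {f | f ∈ classSH ∧ ∃ h g : ℂ → ℂ, IsCanonicalDecomposition f h g ∧ (starRingEnd ℂ) (deriv g 0) = 0}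

/-- The `n`-th Taylor coefficient at the origin. -/
def taylorCoeff (h : ℂ → ℂ) (n : ℕ) : ℂ := iteratedDeriv n h 0 / (n.factorial : ℂ)

/-- A half-integer is an element of `(1/2)ℤ` (integers included). -/
def IsHalfInteger (a : ℂ) : Prop := ∃ m : ℤ, a = (m : ℂ) / 2

/-- All Taylor coefficients of the analytic and of the co-analytic part are half-integers. -/
def HasHalfIntegerCoefficients (f : ℂ → ℂ) : Prop :=
  ∃ h g : ℂ → ℂ, IsCanonicalDecomposition f h g ∧
    ∀ n : ℕ, IsHalfInteger (taylorCoeff h n) ∧ IsHalfInteger (taylorCoeff g n)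

/-- Every line parallel to the line through `0` and `e^{iα}` has a connected (possibly empty)
intersection with `D`. -/
def ConvexInDirection (α : ℝ) (D : Set ℂ) : Prop :=
  ∀ w : ℂ, IsPreconnected ({z : ℂ | ∃ t : ℝ, z = w + t * Complex.exp (α * Complex.I)} ∩ D)

/-- A mapping of the unit disk is convex in the imaginary direction if its image is convex in the
direction `π / 2`. -/
def IsConvexInImaginaryDirection (f : ℂ → ℂ) : Prop :=
  ConvexInDirection (Real.pi / 2) (f '' unitDisk)

/-- The nine analytic functions. -/
def setT5 : Set (ℂ → ℂ) :=
  {fun z => z,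
   fun z => z / (1 + z),
   fun z => z / (1 - z),
   fun z => z / (1 - z ^ 2),
   fun z => z * (2 + z) / (2 * (1 + z)),
   fun z => z * (2 - z) / (2 * (1 - z)),
   fun z => z * (2 - z ^ 2) / (2 * (1 - z ^ 2)),
   fun z => z * (2 + z) / (2 * (1 - z ^ 2)),
   fun z => z * (2 - z) / (2 * (1 - z ^ 2))}

/-- The two non-analytic functions. -/
def setT6 : Set (ℂ → ℂ) :=
  {fun z => ((z / (1 - z)).re : ℂ) + Complex.I * ((z / (1 - z) ^ 2).im : ℂ),
   fun z => ((z / (1 + z)).re : ℂ) + Complex.I * ((z / (1 + z) ^ 2).im : ℂ)}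

end UnivalentHarmonic

end

/-! Write `α n` and `β n` for twice the Taylor coefficients of F = h + g and of g; both are integer
sequences. By the Clunie–Sheil-Small shear, F is univalent and its image is again convex in the
imaginary direction (`shear`). Its coefficients are real, so the image is symmetric in the real
axis.

A moving-plane argument then controls F'. If Im F(z) > 0 and F(w) = F(z) - is with 0 < s < 2 Im
F(z), the maximum principle gives |w| ≤ |z|. Differentiating at s = 0 shows that z F'(z) is
typically real (`im_mul_im_nonneg`), which amounts to (1 - z²) F'(z) having nonnegative real part.
Sense preservation gives the same for (h' - g') / (h' + g'). The cosine moments of such functions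
form positive semidefinite Toeplitz matrices, which yields `IsAdmissible` for F and `IsShearPair`
for the pair.

The rest is arithmetic. The entries are bounded by 1, while the gaps (k+2) α(k+2) - k α(k) are
integers, so few initial values survive; small Toeplitz forms exclude the spurious ones, and from
index 5 on the bounds alone force period two. For g, integrality gives β 2 ∈ {0, 1, -1}. The value 0
forces g = 0 and the nine analytic functions; the values ±1 are extremal and determine both
sequences, giving the two harmonic maps. -/

namespace UnivalentHarmonic

/-! ### Positive semidefinite Toeplitz sequences -/

/-- All Toeplitz forms with entries `t |i - j|` are positive semidefinite. -/
def IsToeplitzNonneg (t : ℕ → ℝ) : Prop :=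
  ∀ (m : ℕ) (k : Fin m → ℕ) (x : Fin m → ℝ),
    0 ≤ ∑ i, ∑ j, x i * x j * t (Nat.dist (k i) (k j))

namespace IsToeplitzNonneg

variable {t : ℕ → ℝ}

lemma three (h : IsToeplitzNonneg t) (h0 : t 0 = 1) (a b : ℕ) (x y z : ℝ) :
    0 ≤ x ^ 2 + y ^ 2 + z ^ 2 + 2 * (x * y * t a + y * z * t b + x * z * t (a + b)) := by
  have := h 3 ![0, a, a + b] ![x, y, z]
  simp [Fin.sum_univ_succ, Nat.dist, h0] at this
  linarith

lemma six (h : IsToeplitzNonneg t) (h0 : t 0 = 1) (a b c d e f : ℝ) :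
    0 ≤ a ^ 2 + b ^ 2 + c ^ 2 + d ^ 2 + e ^ 2 + f ^ 2 +
      2 * ((a * b + b * c + c * d + d * e + e * f) * t 1 + (a * c + b * d + c * e + d * f) * t 2 +
        (a * d + b * e + c * f) * t 3 + (a * e + b * f) * t 4 + a * f * t 5) := by
  have := h 6 ![0, 1, 2, 3, 4, 5] ![a, b, c, d, e, f]
  simp [Fin.sum_univ_succ, Nat.dist, h0] at this
  linarith

lemma abs_le_one (h : IsToeplitzNonneg t) (h0 : t 0 = 1) (n : ℕ) : |t n| ≤ 1 := by
  have h1 := h.three h0 n 0 1 1 0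
  have h2 := h.three h0 n 0 1 (-1) 0
  rw [abs_le]
  constructor <;> linarith

/-- Degenerate case of the 3 × 3 form: with d = t b - t a the chosen vector gives the value -d². The
variants for -1 and for `t a = 1` below work in the same way. -/
lemma eq_of_add_eq_one (h : IsToeplitzNonneg t) (h0 : t 0 = 1) {a b : ℕ} (hab : t (a + b) = 1) :
    t a = t b := by
  have := h.three h0 a b 1 (t b - t a) (-1)
  rw [hab] at this
  nlinarith [sq_nonneg (t b - t a)]

lemma eq_neg_of_add_eq_neg_one (h : IsToeplitzNonneg t) (h0 : t 0 = 1) {a b : ℕ}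
    (hab : t (a + b) = -1) : t a = -t b := by
  have := h.three h0 a b 1 (-t b - t a) 1
  rw [hab] at this
  nlinarith [sq_nonneg (t b + t a)]

lemma add_eq_of_eq_one (h : IsToeplitzNonneg t) (h0 : t 0 = 1) {a : ℕ} (ha : t a = 1) (n : ℕ) :
    t (n + a) = t n := by
  have := h.three h0 a n 1 (-1) (t n - t (n + a))
  rw [ha, add_comm a n] at this
  nlinarith [sq_nonneg (t n - t (n + a))]

lemma eq_one_of_one_eq_one (h : IsToeplitzNonneg t) (h0 : t 0 = 1) (h1 : t 1 = 1) (n : ℕ) :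
    t n = 1 := by
  induction n with
  | zero => exact h0
  | succ n ih => rw [h.add_eq_of_eq_one h0 h1, ih]

/-- Reflection `z ↦ -z` of a nonnegative Toeplitz sequence. -/
lemma alternate (h : IsToeplitzNonneg t) : IsToeplitzNonneg fun n => (-1) ^ n * t n := by
  intro m k x
  refine (h m k fun i => (-1) ^ k i * x i).trans_eq ?_
  refine Finset.sum_congr rfl fun i _ => Finset.sum_congr rfl fun j _ => ?_
  have : ((-1 : ℝ)) ^ k i * (-1) ^ k j = (-1) ^ Nat.dist (k i) (k j) := by
    rw [← pow_add]
    refine neg_one_pow_congr ?_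
    simp only [Nat.even_iff, Nat.dist]
    omega
  linear_combination (x i * x j * t (Nat.dist (k i) (k j))) * this

end IsToeplitzNonneg

/-! ### Integer sequences compatible with a Toeplitz sequence -/

/-- Data for the doubled coefficients `α` of a function convex in the imaginary direction. -/
structure IsAdmissible (α : ℕ → ℤ) (t : ℕ → ℝ) : Prop where
  nonneg : IsToeplitzNonneg t
  zero : t 0 = 1
  one : α 1 = 2
  succ : ∀ k : ℕ, 4 * t (k + 1) = (k + 2) * α (k + 2) - k * α k

namespace IsAdmissible

variable {α : ℕ → ℤ} {t : ℕ → ℝ}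

lemma bounds (h : IsAdmissible α t) (k : ℕ) :
    -4 ≤ (k + 2) * α (k + 2) - k * α k ∧ (k + 2) * α (k + 2) - k * α k ≤ 4 := by
  have h1 := abs_le.1 (h.nonneg.abs_le_one h.zero (k + 1))
  have h2 := h.succ k
  have h3 : (-4 : ℝ) ≤ (k + 2) * α (k + 2) - k * α k := by linarith
  have h4 : ((k + 2) * α (k + 2) - k * α k : ℝ) ≤ 4 := by linarith
  exact ⟨by exact_mod_cast h3, by exact_mod_cast h4⟩

/-- `(k + 2) * α (k + 2)` lies within 4 of `k * e`. For e = 1 this interval excludes 0 only when k >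
4, hence the threshold 5. -/
lemma step (h : IsAdmissible α t) {k : ℕ} (hk : 5 ≤ k) {e : ℤ} (he : e = 0 ∨ e = 1)
    (hα : α k = e) : α (k + 2) = e := by
  have hb := h.bounds k
  rw [hα] at hb
  have hk' : (5 : ℤ) ≤ k := by exact_mod_cast hk
  rcases he with rfl | rfl
  · have h1 : α (k + 2) < 1 := by by_contra! hc; nlinarith
    have h2 : -1 < α (k + 2) := by by_contra! hc; nlinarith
    omega
  · have h1 : α (k + 2) < 2 := by by_contra! hc; nlinarith
    have h2 : 0 < α (k + 2) := by by_contra! hc; nlinarith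
    omega

/-- Corresponds to replacing F(z) by -F(-z); it reverses the sign of `α 2`. -/
lemma alternate (h : IsAdmissible α t) :
    IsAdmissible (fun n => (-1) ^ (n + 1) * α n) fun n => (-1) ^ n * t n where
  nonneg := h.nonneg.alternate
  zero := by simp [h.zero]
  one := by simp [h.one]
  succ k := by
    push_cast
    have := h.succ k
    linear_combination (-1) ^ (k + 1) * this

/-- The conclusion of the classification of admissible sequences. -/
def Classified (α : ℕ → ℤ) : Prop :=
  (∀ n, α (2 * n + 2) = α 2) ∧ (∀ n, α (2 * n + 3) = α 3) ∧
    ((α 2 = 2 ∧ α 3 = 2) ∨ (α 2 = -2 ∧ α 3 = 2) ∨ (α 2 = 0 ∧ α 3 = 0) ∨ (α 2 = 0 ∧ α 3 = 1) ∨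
      (α 2 = 0 ∧ α 3 = 2) ∨ (α 2 = 1 ∧ α 3 = 1) ∨ (α 2 = -1 ∧ α 3 = 1) ∨ (α 2 = 1 ∧ α 3 = 2) ∨
      (α 2 = -1 ∧ α 3 = 2))

/-- Here `t 2 = 1` is extremal, so `t` has period two and the recursion for `α` has constant
solutions along each parity. -/
lemma periodic_of_three_eq_two (h : IsAdmissible α t) (h3 : α 3 = 2) :
    (∀ n, α (2 * n + 2) = α 2) ∧ (∀ n, α (2 * n + 3) = α 3) := by
  have ht2 : t 2 = 1 := by
    have := h.succ 1
    rw [h.one, show 1 + 2 = 3 from rfl, h3] at this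
    norm_num at this
    linarith
  have hp := fun n => h.nonneg.add_eq_of_eq_one h.zero (a := 2) ht2 n
  have hodd : ∀ n, t (2 * n + 1) = t 1 := by
    intro n
    induction n with
    | zero => rfl
    | succ n ih => rw [← ih, ← hp (2 * n + 1)]; congr 1
  have heven : ∀ n, t (2 * n + 2) = 1 := by
    intro n
    induction n with
    | zero => exact ht2
    | succ n ih => rw [← ih, ← hp (2 * n + 2)]; congr 1
  have ht1 : 4 * t 1 = 2 * α 2 := by simpa using h.succ 0
  constructor
  · intro n
    induction n with
    | zero => rfl
    | succ n ih =>
      have := h.succ (2 * n + 2)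
      rw [ih, show 2 * n + 2 + 1 = 2 * (n + 1) + 1 by ring, hodd, ht1] at this
      have h5 : ((2 * n + 4 : ℕ) : ℝ) * (α (2 * (n + 1) + 2) : ℝ) = (2 * n + 4 : ℕ) * (α 2 : ℝ) := by
        push_cast at this ⊢
        rw [show 2 * (n + 1) + 2 = 2 * n + 2 + 2 by ring]
        linarith
      exact_mod_cast mul_left_cancel₀ (by positivity) h5
  · intro n
    induction n with
    | zero => rfl
    | succ n ih =>
      have := h.succ (2 * n + 3)
      rw [ih, show 2 * n + 3 + 1 = 2 * (n + 1) + 2 by ring, heven, h3] at this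
      have h5 : ((2 * n + 5 : ℕ) : ℝ) * (α (2 * (n + 1) + 3) : ℝ) = (2 * n + 5 : ℕ) * (2 : ℝ) := by
        push_cast at this ⊢
        rw [show 2 * (n + 1) + 3 = 2 * n + 3 + 2 by ring]
        linarith
      rw [h3]
      exact_mod_cast mul_left_cancel₀ (by positivity) h5

lemma periodic_of_six (h : IsAdmissible α t) (h2 : α 2 = 0 ∨ α 2 = 1) (h3 : α 3 = 0 ∨ α 3 = 1)
    (h4 : α 4 = α 2) (h5 : α 5 = α 3) (h6 : α 6 = α 2) :
    (∀ n, α (2 * n + 2) = α 2) ∧ (∀ n, α (2 * n + 3) = α 3) := by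
  have he : ∀ n, α (2 * n + 6) = α 2 := by
    intro n
    induction n with
    | zero => exact h6
    | succ n ih => exact h.step (k := 2 * n + 6) (by omega) h2 ih
  have ho : ∀ n, α (2 * n + 5) = α 3 := by
    intro n
    induction n with
    | zero => exact h5
    | succ n ih => exact h.step (k := 2 * n + 5) (by omega) h3 ih
  constructor
  · rintro (_ | _ | n)
    exacts [rfl, h4, he n]
  · rintro (_ | n)
    exacts [rfl, ho n]

/-- The bounds leave `α 2` and `α 3` in {0, 1, 2}. Each branch either has an extremal entry of `t`,
or agrees with a period-two pattern up to index 6, or violates an explicit Toeplitz form. -/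
lemma classified_of_nonneg (h : IsAdmissible α t) (hα2 : 0 ≤ α 2) : Classified α := by
  have b0 := h.bounds 0
  have b1 := h.bounds 1
  have b2 := h.bounds 2
  have b3 := h.bounds 3
  have b4 := h.bounds 4
  have b5 := h.bounds 5
  have s0 := h.succ 0
  have s1 := h.succ 1
  have s2 := h.succ 2
  have s3 := h.succ 3
  have s4 := h.succ 4
  have s5 := h.succ 5
  norm_num [h.one] at b0 b1 b2 b3 b4 b5 s0 s1 s2 s3 s4 s5
  have hα3 : α 3 = 0 ∨ α 3 = 1 ∨ α 3 = 2 := by omega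
  have hα2' : α 2 = 0 ∨ α 2 = 1 ∨ α 2 = 2 := by omega
  rcases hα2' with h2 | h2 | h2
  -- If `α 4 = ±1`, then `t 3 = ±1` and so `t 1 = ±t 2`; but `t 1 = 0`, while `t 2` is -1/2 or 1/4.
  · have h4 : α 3 = 2 ∨ α 4 = 0 := by
      by_contra! hc
      have h4 : α 4 = 1 ∨ α 4 = -1 := by omega
      rcases (by omega : α 3 = 0 ∨ α 3 = 1) with h3 | h3
      all_goals
        rcases h4 with h4 | h4
        · norm_num [h2, h3, h4] at s0 s1 s2 hc
          have := h.nonneg.eq_of_add_eq_one h.zero (a := 1) (b := 2) (by norm_num; linarith)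
          linarith
        · norm_num [h2, h3, h4] at s0 s1 s2 hc
          have := h.nonneg.eq_neg_of_add_eq_neg_one h.zero (a := 1) (b := 2) (by norm_num; linarith)
          linarith
    rcases hα3 with h3 | h3 | h3
    · have h4 : α 4 = 0 := by omega
      have := h.periodic_of_six (by omega) (by omega) (by omega) (by omega) (by omega)
      exact ⟨this.1, this.2, by omega⟩
    · have h4 : α 4 = 0 := by omega
      have h5 : α 5 = 1 := by
        by_contra hc
        have h5 : α 5 = 0 := by omega
        have h7 : α 7 = 0 := by omega
        norm_num [h2, h3, h4, h5, h7] at s1 s3 s5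
        -- With `t 2 = 1/4`, `t 4 = -3/4`, `t 6 = 0` this form equals -1/2.
        have := h.nonneg 4 ![0, 2, 4, 6] ![1, -1, 1, -1]
        simp [Fin.sum_univ_succ, Nat.dist, h.zero] at this
        linarith
      have := h.periodic_of_six (by omega) (by omega) (by omega) (by omega) (by omega)
      exact ⟨this.1, this.2, by omega⟩
    · have := h.periodic_of_three_eq_two h3
      exact ⟨this.1, this.2, by omega⟩
  · rcases hα3 with h3 | h3 | h3
    · exfalso
      norm_num [h2, h3] at s0 s1 s2
      -- Since `t 1 = 1/2` and `t 2 = -1/2`, the vector (1, -1, 1) is null for the 3 × 3 form. Its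
      -- pairing `t 3 - t 2 + t 1` with the next basis vector must vanish, giving `t 3 = -1` and `4
      -- * α 4 = -2`.
      have h6 := h.nonneg.six h.zero 1 (-1) 1 (-(t 3 - t 2 + t 1)) 0 0
      have h7 : t 3 - t 2 + t 1 = 0 := by
        have h8 : t 1 = 1 / 2 := by linarith
        have h9 : t 2 = -1 / 2 := by linarith
        rw [h8, h9] at h6 ⊢
        nlinarith [sq_nonneg (t 3 + 1)]
      have h8 : ((4 * α 4 : ℤ) : ℝ) = (-2 : ℤ) := by push_cast; linarith
      have := Int.cast_injective h8
      omega
    · norm_num [h2, h3] at s0 s1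
      have h4 : α 4 = 1 := by
        by_contra hc
        have h4 : α 4 = 0 := by omega
        have h6 : α 6 = 0 := by omega
        have h5 : α 5 = 0 ∨ α 5 = 1 := by omega
        norm_num [h2, h4, h6] at s2 s4
        rcases h5 with h5 | h5
        · norm_num [h3, h5] at s3
          -- The integer vectors in these branches are witnesses on which the 6 × 6 form is
          -- negative.
          have := h.nonneg.six h.zero 5 (-4) 0 0 4 (-5)
          linarith
        · norm_num [h3, h5] at s3
          have := h.nonneg.six h.zero (-3) 0 4 (-4) 0 3
          linarith
      norm_num [h2, h4] at s2
      have h6 : α 6 = 1 := by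
        by_contra hc
        have h6 : α 6 = 0 := by omega
        norm_num [h4, h6] at s4
        have := h.nonneg.eq_neg_of_add_eq_neg_one h.zero (a := 2) (b := 3) (by norm_num; linarith)
        linarith
      have h5 : α 5 = 1 := by
        by_contra hc
        have h5 : α 5 = 0 := by omega
        norm_num [h3, h5] at s3
        have := h.nonneg.six h.zero 2 (-1) 0 (-1) 2 0
        linarith
      have := h.periodic_of_six (by omega) (by omega) (by omega) (by omega) (by omega)
      exact ⟨this.1, this.2, by omega⟩
    · have := h.periodic_of_three_eq_two h3
      exact ⟨this.1, this.2, by omega⟩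
  · norm_num [h2] at s0
    have := h.nonneg.eq_one_of_one_eq_one h.zero (by linarith) 2
    have h3 : α 3 = 2 := by
      have : ((α 3 : ℤ) : ℝ) = (2 : ℤ) := by push_cast; linarith
      exact Int.cast_injective this
    have := h.periodic_of_three_eq_two h3
    exact ⟨this.1, this.2, by omega⟩

theorem classified (h : IsAdmissible α t) : Classified α := by
  rcases le_total 0 (α 2) with h2 | h2
  · exact h.classified_of_nonneg h2
  · obtain ⟨he, ho, hc⟩ := h.alternate.classified_of_nonneg (by norm_num; exact h2)
    have e1 : ∀ n, (-1 : ℤ) ^ (2 * n + 2 + 1) = -1 := fun n => by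
      rw [show 2 * n + 2 + 1 = 2 * (n + 1) + 1 by ring, pow_succ, pow_mul]; norm_num
    have e2 : ∀ n, (-1 : ℤ) ^ (2 * n + 3 + 1) = 1 := fun n => by
      rw [show 2 * n + 3 + 1 = 2 * (n + 2) by ring, pow_mul]; norm_num
    norm_num at hc
    refine ⟨fun n => ?_, fun n => ?_, by omega⟩
    · have := he n
      simp only [e1] at this
      norm_num at this
      exact this
    · have := ho n
      simp only [e2] at this
      norm_num at this
      exact this

end IsAdmissible

/-! ### Joint classification of the coefficients of h + g and g -/

/-- Data relating the doubled coefficients of `h + g` and of `g` through the coefficients of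
`(h' - g') / (h' + g')`. -/
structure IsShearPair (α β : ℕ → ℤ) (s : ℕ → ℝ) : Prop where
  nonneg : IsToeplitzNonneg s
  zero : s 0 = 1
  conv : ∀ n : ℕ, ∑ i ∈ Finset.range n, s (i + 1) * ((n - i : ℕ) * α (n - i)) =
    -((n + 1) * β (n + 1))

namespace IsShearPair

variable {α β : ℕ → ℤ} {s t : ℕ → ℝ}

lemma two (h : IsShearPair α β s) (h1 : α 1 = 2) : s 1 = -β 2 := by
  have := h.conv 1
  norm_num [h1] at this
  linarith

/-- If the earlier `s` vanish, the convolution reduces to `2 * s (n + 1) = -(n + 2) * β (n + 2)`.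
For n ≥ 1 the bound on `s` makes the integer `β (n + 2)` zero, and then `s (n + 1)` is zero too. -/
lemma beta_eq_zero (h : IsShearPair α β s) (h1 : α 1 = 2) (h2 : β 2 = 0) (n : ℕ) :
    β (n + 2) = 0 ∧ s (n + 1) = 0 := by
  induction n using Nat.strong_induction_on with
  | _ n ih =>
    have hc := h.conv (n + 1)
    rw [Finset.sum_range_succ, Finset.sum_eq_zero] at hc
    · norm_num [h1] at hc
      have hb := abs_le.1 (h.nonneg.abs_le_one h.zero (n + 1))
      have hβ : β (n + 2) = 0 := by
        rcases Nat.eq_zero_or_pos n with rfl | hn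
        · exact h2
        · have h3 : ((-2 : ℤ) : ℝ) ≤ (((n : ℤ) + 2) * β (n + 2) : ℤ) := by push_cast; linarith
          have h4 : (((n : ℤ) + 2) * β (n + 2) : ℤ) ≤ ((2 : ℤ) : ℝ) := by push_cast; linarith
          rw [Int.cast_le] at h3 h4
          have h5 : β (n + 2) < 1 := by by_contra! hcon; nlinarith
          have h6 : -1 < β (n + 2) := by by_contra! hcon; nlinarith
          omega
      refine ⟨hβ, ?_⟩
      rw [show n + 1 + 1 = n + 2 from rfl, hβ] at hc
      norm_num at hc
      exact hc
    · intro i hi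
      rw [(ih i (Finset.mem_range.1 hi)).2, zero_mul]

lemma of_beta_two_eq_neg_one (h : IsShearPair α β s) (ha : IsAdmissible α t) (h2 : β 2 = -1) :
    ∀ n, α (n + 1) = 2 ∧ β (n + 1) = -n := by
  have hs := h.nonneg.eq_one_of_one_eq_one h.zero (by rw [h.two ha.one, h2]; norm_num)
  have hconv : ∀ n : ℕ, ∑ i ∈ Finset.range n, (((n - i : ℕ) : ℤ) * α (n - i)) =
      -((n + 1) * β (n + 1)) := by
    intro n
    have := h.conv n
    simp only [hs, one_mul] at this
    exact_mod_cast this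
  -- These say 3 ∣ 2 α 2 + 2 and 4 ∣ 3 α 3 + 2 α 2 + 2. Among the nine classified pairs only (2, 2)
  -- satisfies both.
  have c2 := hconv 2
  have c3 := hconv 3
  norm_num [Finset.sum_range_succ, ha.one] at c2 c3
  obtain ⟨he, ho, hc⟩ := ha.classified
  have hα2 : α 2 = 2 := by omega
  have hα3 : α 3 = 2 := by omega
  have hα : ∀ n, α (n + 1) = 2 := by
    intro n
    rcases Nat.even_or_odd' n with ⟨m, rfl | rfl⟩
    · rcases m with _ | m
      · exact ha.one
      · exact (ho m).trans hα3
    · exact (he m).trans hα2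
  intro n
  refine ⟨hα n, ?_⟩
  have h3 : ∑ i ∈ Finset.range n, (((n - i : ℕ) : ℤ) * α (n - i)) = n * (n + 1) := by
    have : ∑ i ∈ Finset.range n, (((n - i : ℕ) : ℤ) * α (n - i)) =
        ∑ i ∈ Finset.range n, (((n - 1 - i + 1 : ℕ) : ℤ) * 2) := by
      refine Finset.sum_congr rfl fun i hi => ?_
      have := Finset.mem_range.1 hi
      rw [show n - i = n - 1 - i + 1 by omega, hα]
    rw [this, Finset.sum_range_reflect (fun i => ((i + 1 : ℕ) : ℤ) * 2) n]
    clear * -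
    induction n with
    | zero => rfl
    | succ n ih => rw [Finset.sum_range_succ, ih]; push_cast; ring
  rw [hconv] at h3
  have : ((n : ℤ) + 1) * β (n + 1) = (n + 1) * (-n) := by linarith
  exact mul_left_cancel₀ (by positivity) this

lemma alternate (h : IsShearPair α β s) :
    IsShearPair (fun n => (-1) ^ (n + 1) * α n) (fun n => (-1) ^ (n + 1) * β n)
      fun n => (-1) ^ n * s n where
  nonneg := h.nonneg.alternate
  zero := by simp [h.zero]
  conv n := by
    have hc := h.conv n
    have : ∑ i ∈ Finset.range n, (-1 : ℝ) ^ (i + 1) * s (i + 1) *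
        ((n - i : ℕ) * ((-1) ^ (n - i + 1) * α (n - i))) =
        ∑ i ∈ Finset.range n, (-1) ^ (n + 2) * (s (i + 1) * ((n - i : ℕ) * α (n - i))) := by
      refine Finset.sum_congr rfl fun i hi => ?_
      have := Finset.mem_range.1 hi
      rw [show n + 2 = (i + 1) + (n - i + 1) by omega, pow_add]
      ring
    push_cast
    rw [this, ← Finset.mul_sum, hc]
    ring

/-- Classification of the doubled coefficients of `h + g` and `g`. -/
theorem classified (h : IsShearPair α β s) (ha : IsAdmissible α t) :
    (IsAdmissible.Classified α ∧ ∀ n, β (n + 2) = 0) ∨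
    (∀ n, α (n + 1) = 2 ∧ β (n + 1) = -n) ∨
    (∀ n, α (n + 1) = 2 * (-1) ^ n ∧ β (n + 1) = -n * (-1) ^ n) := by
  have hb := abs_le.1 (h.nonneg.abs_le_one h.zero 1)
  rw [h.two ha.one] at hb
  have hb1 : β 2 ≤ 1 := by
    have : (β 2 : ℝ) ≤ (1 : ℤ) := by push_cast; linarith
    exact_mod_cast this
  have hb2 : -1 ≤ β 2 := by
    have : ((-1 : ℤ) : ℝ) ≤ β 2 := by push_cast; linarith
    exact_mod_cast this
  obtain h2 | h2 | h2 : β 2 = 0 ∨ β 2 = -1 ∨ β 2 = 1 := by omega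
  · exact Or.inl ⟨ha.classified, fun n => (h.beta_eq_zero ha.one h2 n).1⟩
  · exact Or.inr (Or.inl (h.of_beta_two_eq_neg_one ha h2))
  · refine Or.inr (Or.inr fun n => ?_)
    have := h.alternate.of_beta_two_eq_neg_one ha.alternate (by simp [h2]) n
    have hsq : ((-1 : ℤ) ^ n) * (-1) ^ n = 1 := by rw [← mul_pow]; simp
    have e : (-1 : ℤ) ^ (n + 1 + 1) = (-1) ^ n := by ring
    rw [e] at this
    obtain ⟨h3, h4⟩ := this
    constructor
    · linear_combination (-1) ^ n * h3 - α (n + 1) * hsq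
    · linear_combination (-1) ^ n * h4 - β (n + 1) * hsq

end IsShearPair

end UnivalentHarmonic

/-! ### Cosine series and their Toeplitz moments -/

namespace UnivalentHarmonic

lemma integral_cos_int_mul (j : ℤ) :
    ∫ θ in (0 : ℝ)..(2 * Real.pi), Real.cos (j * θ) = if j = 0 then 2 * Real.pi else 0 := by
  split_ifs with hj
  · simp [hj]
  · have hj' : (j : ℝ) ≠ 0 := by exact_mod_cast hj
    rw [intervalIntegral.integral_comp_mul_left (fun x => Real.cos x) hj', integral_cos]
    have : Real.sin (j * (2 * Real.pi)) = 0 := by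
      have := Real.sin_int_mul_pi (j * 2)
      push_cast at this
      rw [← this]; ring_nf
    simp [this]

lemma integral_cos_mul_cos (n m : ℕ) :
    ∫ θ in (0 : ℝ)..(2 * Real.pi), Real.cos (n * θ) * Real.cos (m * θ) =
      if n = m then (if m = 0 then 2 * Real.pi else Real.pi) else 0 := by
  have h : ∀ θ : ℝ, Real.cos (n * θ) * Real.cos (m * θ) =
      (1 / 2) * Real.cos (((n - m : ℤ) : ℝ) * θ) + (1 / 2) * Real.cos (((n + m : ℤ) : ℝ) * θ) := by
    intro θ
    push_cast
    rw [sub_mul, add_mul, Real.cos_sub, Real.cos_add]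
    ring
  simp_rw [h]
  rw [intervalIntegral.integral_add (Continuous.intervalIntegrable (by fun_prop) _ _)
    (Continuous.intervalIntegrable (by fun_prop) _ _), intervalIntegral.integral_const_mul,
    intervalIntegral.integral_const_mul, integral_cos_int_mul, integral_cos_int_mul]
  rcases eq_or_ne n m with rfl | hnm
  · rcases eq_or_ne n 0 with rfl | hn
    · simp; ring
    · have : (n : ℤ) + n ≠ 0 := by omega
      simp [hn]
  · have h1 : (n : ℤ) - m ≠ 0 := by omega
    have h2 : (n : ℤ) + m ≠ 0 := by omega
    rw [if_neg h1, if_neg h2, if_neg hnm]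
    ring

/-- The cosine moments of the sum of an absolutely convergent cosine series. -/
noncomputable def cosMoment (p : ℕ → ℝ) (n : ℕ) : ℝ := if n = 0 then p 0 else p n / 2

lemma continuous_cos_series {p : ℕ → ℝ} (hp : Summable fun n => |p n|) :
    Continuous fun θ : ℝ => ∑' n, p n * Real.cos (n * θ) := by
  refine continuous_tsum (fun n => by fun_prop) hp fun n θ => ?_
  rw [Real.norm_eq_abs, abs_mul]
  exact mul_le_of_le_one_right (abs_nonneg _) (Real.abs_cos_le_one _)

lemma integral_cos_series {p : ℕ → ℝ} (hp : Summable fun n => |p n|) (m : ℕ) :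
    ∫ θ in (0 : ℝ)..(2 * Real.pi), (∑' n, p n * Real.cos (n * θ)) * Real.cos (m * θ) =
      2 * Real.pi * cosMoment p m := by
  have hb : ∀ (n : ℕ) (θ : ℝ), |p n * Real.cos (n * θ)| ≤ |p n| := fun n θ => by
    rw [abs_mul]
    exact mul_le_of_le_one_right (abs_nonneg _) (Real.abs_cos_le_one _)
  have hb' : ∀ (n : ℕ) (θ : ℝ), ‖p n * Real.cos (n * θ) * Real.cos (m * θ)‖ ≤ |p n| := fun n θ => by
    rw [Real.norm_eq_abs, abs_mul]
    exact (mul_le_of_le_one_right (abs_nonneg _) (Real.abs_cos_le_one _)).trans (hb n θ)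
  have hs : ∀ θ : ℝ, HasSum (fun n : ℕ => p n * Real.cos (n * θ) * Real.cos (m * θ))
      ((∑' n : ℕ, p n * Real.cos (n * θ)) * Real.cos (m * θ)) := by
    intro θ
    have h1 : Summable fun n : ℕ => p n * Real.cos (n * θ) := Summable.of_norm_bounded hp fun n => by
      rw [Real.norm_eq_abs]
      exact hb n θ
    exact h1.hasSum.mul_right _
  have hi : IntervalIntegrable (fun _ : ℝ => ∑' n, |p n|) MeasureTheory.volume 0 (2 * Real.pi) :=
    intervalIntegrable_const
  have h : HasSum (fun n : ℕ => ∫ θ in (0 : ℝ)..(2 * Real.pi),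
      p n * Real.cos (n * θ) * Real.cos (m * θ))
      (∫ θ in (0 : ℝ)..(2 * Real.pi), (∑' n : ℕ, p n * Real.cos (n * θ)) * Real.cos (m * θ)) :=
    intervalIntegral.hasSum_integral_of_dominated_convergence (fun n _ => |p n|)
      (fun n => Continuous.aestronglyMeasurable (by fun_prop))
      (fun n => Filter.Eventually.of_forall fun θ _ => hb' n θ)
      (Filter.Eventually.of_forall fun θ _ => hp) hi
      (Filter.Eventually.of_forall fun θ _ => hs θ)
  refine h.unique ?_
  have hterm : ∀ n : ℕ, ∫ θ in (0 : ℝ)..(2 * Real.pi), p n * Real.cos (n * θ) * Real.cos (m * θ) =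
      if n = m then p m * (if m = 0 then 2 * Real.pi else Real.pi) else 0 := by
    intro n
    simp_rw [mul_assoc]
    rw [intervalIntegral.integral_const_mul, integral_cos_mul_cos]
    split_ifs <;> simp_all
  simp_rw [hterm]
  convert hasSum_ite_eq m (p m * (if m = 0 then 2 * Real.pi else Real.pi)) using 1
  unfold cosMoment
  split_ifs with hm
  · rw [hm]; ring
  · ring

lemma cos_natDist (a b : ℕ) (θ : ℝ) :
    Real.cos (Nat.dist a b * θ) =
      Real.cos (a * θ) * Real.cos (b * θ) + Real.sin (a * θ) * Real.sin (b * θ) := by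
  rw [← Real.cos_sub, ← sub_mul]
  rcases le_total a b with h | h
  · rw [Nat.dist_eq_sub_of_le h, Nat.cast_sub h, ← Real.cos_neg]
    congr 1
    ring
  · rw [Nat.dist_eq_sub_of_le_right h, Nat.cast_sub h]

/-- The cosine moments of a nonnegative cosine series have positive semidefinite Toeplitz forms. -/
theorem isToeplitzNonneg_cosMoment {p : ℕ → ℝ} (hp : Summable fun n => |p n|)
    (h : ∀ θ : ℝ, 0 ≤ ∑' n, p n * Real.cos (n * θ)) : IsToeplitzNonneg (cosMoment p) := by
  intro m k x
  set f : ℝ → ℝ := fun θ => ∑' n, p n * Real.cos (n * θ) with hf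
  have hc : Continuous f := continuous_cos_series hp
  have hint : ∫ θ in (0 : ℝ)..(2 * Real.pi),
      ∑ i, ∑ j, x i * x j * (f θ * Real.cos (Nat.dist (k i) (k j) * θ)) =
      2 * Real.pi * ∑ i, ∑ j, x i * x j * cosMoment p (Nat.dist (k i) (k j)) := by
    rw [intervalIntegral.integral_finsetSum
      (fun i _ => Continuous.intervalIntegrable (by fun_prop) _ _), Finset.mul_sum]
    refine Finset.sum_congr rfl fun i _ => ?_
    rw [intervalIntegral.integral_finsetSum
      (fun i _ => Continuous.intervalIntegrable (by fun_prop) _ _), Finset.mul_sum]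
    refine Finset.sum_congr rfl fun j _ => ?_
    rw [intervalIntegral.integral_const_mul, hf, integral_cos_series hp]
    ring
  have hnn : 0 ≤ ∫ θ in (0 : ℝ)..(2 * Real.pi),
      ∑ i, ∑ j, x i * x j * (f θ * Real.cos (Nat.dist (k i) (k j) * θ)) := by
    refine intervalIntegral.integral_nonneg (by positivity) fun θ _ => ?_
    -- The Toeplitz form integrates f against |∑ x_i exp(i k_i θ)|².
    have : ∑ i, ∑ j, x i * x j * (f θ * Real.cos (Nat.dist (k i) (k j) * θ)) =
        f θ * ((∑ i, x i * Real.cos (k i * θ)) ^ 2 + (∑ i, x i * Real.sin (k i * θ)) ^ 2) := by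
      rw [sq, sq, Finset.sum_mul_sum, Finset.sum_mul_sum, ← Finset.sum_add_distrib, Finset.mul_sum]
      refine Finset.sum_congr rfl fun i _ => ?_
      rw [← Finset.sum_add_distrib, Finset.mul_sum]
      refine Finset.sum_congr rfl fun j _ => ?_
      rw [cos_natDist]
      ring
    rw [this]
    exact mul_nonneg (h θ) (by positivity)
  rw [hint] at hnn
  exact nonneg_of_mul_nonneg_right hnn (by positivity)

/-- Absolute convergence is available only on circles of radius r < 1. Each Toeplitz form is a
finite sum, so its sign survives r → 1. -/
lemma IsToeplitzNonneg.of_tendsto {T : ℝ → ℕ → ℝ} {t : ℕ → ℝ}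
    (hT : ∀ r, 0 < r → r < 1 → IsToeplitzNonneg (T r))
    (ht : ∀ n, Filter.Tendsto (fun r => T r n) (nhdsWithin 1 (Set.Iio 1)) (nhds (t n))) :
    IsToeplitzNonneg t := by
  intro m k x
  have hlim : Filter.Tendsto (fun r => ∑ i, ∑ j, x i * x j * T r (Nat.dist (k i) (k j)))
      (nhdsWithin 1 (Set.Iio 1)) (nhds (∑ i, ∑ j, x i * x j * t (Nat.dist (k i) (k j)))) :=
    tendsto_finsetSum _ fun i _ => tendsto_finsetSum _ fun j _ => (ht _).const_mul _
  refine ge_of_tendsto hlim ?_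
  filter_upwards [Ioo_mem_nhdsLT (zero_lt_one' ℝ)] with r hr
  exact hT r hr.1 hr.2 m k x

end UnivalentHarmonic

/-! ### Taylor coefficients on the disk and uniqueness of the decomposition -/

namespace UnivalentHarmonic

open Complex

lemma isOpen_unitDisk : IsOpen unitDisk := Metric.isOpen_ball

lemma mem_unitDisk {z : ℂ} : z ∈ unitDisk ↔ ‖z‖ < 1 := by simp [unitDisk]

lemma zero_mem_unitDisk : (0 : ℂ) ∈ unitDisk := by simp [mem_unitDisk]

lemma conj_mem_unitDisk {z : ℂ} (hz : z ∈ unitDisk) : (starRingEnd ℂ) z ∈ unitDisk := by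
  rw [mem_unitDisk] at *
  simpa using hz

section TaylorCoeff

variable {u v : ℂ → ℂ}

lemma hasSum_taylorCoeff (hu : DifferentiableOn ℂ u unitDisk) {z : ℂ} (hz : z ∈ unitDisk) :
    HasSum (fun n => taylorCoeff u n * z ^ n) (u z) := by
  have hn : ∀ n : ℕ, (n.factorial : ℂ)⁻¹ • (z - 0) ^ n • iteratedDeriv n u 0 =
      taylorCoeff u n * z ^ n := fun n => by
    simp only [taylorCoeff, sub_zero, smul_eq_mul]
    ring
  have := hasSum_taylorSeries_on_ball hu hz
  simp only [hn] at this
  exact this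

lemma contDiffAt_zero (hu : DifferentiableOn ℂ u unitDisk) (n : WithTop ℕ∞) :
    ContDiffAt ℂ n u 0 :=
  (hu.analyticAt (isOpen_unitDisk.mem_nhds zero_mem_unitDisk)).contDiffAt

lemma taylorCoeff_congr (h : Set.EqOn u v unitDisk) (n : ℕ) : taylorCoeff u n = taylorCoeff v n := by
  have : u =ᶠ[nhds 0] v := h.eventuallyEq_of_mem (isOpen_unitDisk.mem_nhds zero_mem_unitDisk)
  rw [taylorCoeff, taylorCoeff, this.iteratedDeriv_eq]

lemma taylorCoeff_zero (u : ℂ → ℂ) : taylorCoeff u 0 = u 0 := by simp [taylorCoeff]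

lemma taylorCoeff_one (u : ℂ → ℂ) : taylorCoeff u 1 = deriv u 0 := by simp [taylorCoeff]

lemma taylorCoeff_deriv (u : ℂ → ℂ) (n : ℕ) :
    taylorCoeff (deriv u) n = (n + 1) * taylorCoeff u (n + 1) := by
  rw [taylorCoeff, taylorCoeff, ← iteratedDeriv_succ', Nat.factorial_succ]
  have h1 : (n.factorial : ℂ) ≠ 0 := by exact_mod_cast n.factorial_ne_zero
  have h2 : (n + 1 : ℂ) ≠ 0 := by exact_mod_cast n.succ_ne_zero
  push_cast
  field_simp

lemma taylorCoeff_add (hu : DifferentiableOn ℂ u unitDisk) (hv : DifferentiableOn ℂ v unitDisk)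
    (n : ℕ) : taylorCoeff (fun z => u z + v z) n = taylorCoeff u n + taylorCoeff v n := by
  rw [taylorCoeff, iteratedDeriv_fun_add (contDiffAt_zero hu _) (contDiffAt_zero hv _), add_div]
  rfl

lemma taylorCoeff_sub (hu : DifferentiableOn ℂ u unitDisk) (hv : DifferentiableOn ℂ v unitDisk)
    (n : ℕ) : taylorCoeff (fun z => u z - v z) n = taylorCoeff u n - taylorCoeff v n := by
  rw [taylorCoeff, iteratedDeriv_fun_sub (contDiffAt_zero hu _) (contDiffAt_zero hv _), sub_div]
  rfl

lemma taylorCoeff_mul (hu : DifferentiableOn ℂ u unitDisk) (hv : DifferentiableOn ℂ v unitDisk)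
    (n : ℕ) : taylorCoeff (fun z => u z * v z) n =
      ∑ i ∈ Finset.range (n + 1), taylorCoeff u i * taylorCoeff v (n - i) := by
  rw [taylorCoeff, iteratedDeriv_fun_mul (contDiffAt_zero hu _) (contDiffAt_zero hv _),
    Finset.sum_div]
  refine Finset.sum_congr rfl fun i hi => ?_
  have hi' : i ≤ n := Nat.lt_succ_iff.1 (Finset.mem_range.1 hi)
  rw [taylorCoeff, taylorCoeff, ← Nat.choose_mul_factorial_mul_factorial hi']
  have h1 : (i.factorial : ℂ) ≠ 0 := by exact_mod_cast i.factorial_ne_zero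
  have h2 : ((n - i).factorial : ℂ) ≠ 0 := by exact_mod_cast (n - i).factorial_ne_zero
  have h3 : (n.choose i : ℂ) ≠ 0 := by exact_mod_cast (Nat.choose_pos hi').ne'
  push_cast
  field_simp

lemma map_conj_of_real_taylorCoeff (hu : DifferentiableOn ℂ u unitDisk) {c : ℕ → ℝ}
    (hc : ∀ n, taylorCoeff u n = c n) {z : ℂ} (hz : z ∈ unitDisk) :
    u ((starRingEnd ℂ) z) = (starRingEnd ℂ) (u z) := by
  refine (hasSum_taylorCoeff hu (conj_mem_unitDisk hz)).unique ?_
  convert (Complex.hasSum_conj'.2 (hasSum_taylorCoeff hu hz)) using 2 with n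
  simp [hc]

lemma summable_abs_mul_pow (hu : DifferentiableOn ℂ u unitDisk) {c : ℕ → ℝ}
    (hc : ∀ n, taylorCoeff u n = c n) {r : ℝ} (h0 : 0 ≤ r) (h1 : r < 1) :
    Summable fun n => |c n * r ^ n| := by
  have hz : (r : ℂ) ∈ unitDisk := by
    rw [mem_unitDisk, Complex.norm_real, Real.norm_eq_abs, abs_of_nonneg h0]
    exact h1
  have := (hasSum_taylorCoeff hu hz).summable.norm
  refine this.congr fun n => ?_
  rw [hc, ← Complex.ofReal_pow, ← Complex.ofReal_mul, Complex.norm_real, Real.norm_eq_abs]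

/-- The factor `w` shifts frequencies by `m`; m = 2 serves the product (1 - e^{2iθ}) F'. -/
lemma hasSum_cos (hu : DifferentiableOn ℂ u unitDisk) {c : ℕ → ℝ}
    (hc : ∀ n, taylorCoeff u n = c n) {r : ℝ} (h0 : 0 ≤ r) (h1 : r < 1) (θ : ℝ) (w : ℂ) (m : ℕ)
    (hw : w = Complex.exp (m * θ * Complex.I)) :
    HasSum (fun n : ℕ => c n * r ^ n * Real.cos ((n + m : ℕ) * θ))
      (w * u (r * Complex.exp (θ * Complex.I))).re := by
  have hz : (r * Complex.exp (θ * Complex.I) : ℂ) ∈ unitDisk := by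
    rw [mem_unitDisk, norm_mul, Complex.norm_exp_ofReal_mul_I, Complex.norm_real, Real.norm_eq_abs,
      abs_of_nonneg h0, mul_one]
    exact h1
  convert Complex.hasSum_re ((hasSum_taylorCoeff hu hz).mul_left w) using 2 with n
  rw [hc, hw, mul_pow, ← Complex.exp_nat_mul]
  have : Complex.exp (m * θ * Complex.I) * (c n * (r ^ n * Complex.exp (n * (θ * Complex.I)))) =
      (c n * r ^ n : ℝ) * Complex.exp (((n + m : ℕ) * θ : ℝ) * Complex.I) := by
    push_cast
    rw [show ((n : ℂ) + m) * θ * Complex.I = m * θ * Complex.I + n * (θ * Complex.I) by ring,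
      Complex.exp_add]
    ring
  rw [this, Complex.re_ofReal_mul, Complex.exp_ofReal_mul_I_re]

end TaylorCoeff

/-- The canonical decomposition of a harmonic mapping is unique on the disk. -/
lemma IsCanonicalDecomposition.eqOn {f h₁ g₁ h₂ g₂ : ℂ → ℂ} (H₁ : IsCanonicalDecomposition f h₁ g₁)
    (H₂ : IsCanonicalDecomposition f h₂ g₂) :
    Set.EqOn h₁ h₂ unitDisk ∧ Set.EqOn g₁ g₂ unitDisk := by
  have hconn : IsConnected unitDisk :=
    ⟨⟨0, zero_mem_unitDisk⟩, (convex_ball (0 : ℂ) 1).isPreconnected⟩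
  have key : ∀ z ∈ unitDisk, h₁ z - h₂ z = -(starRingEnd ℂ) (g₁ z - g₂ z) := by
    intro z hz
    have := (H₁.eq_add_conj z hz).symm.trans (H₂.eq_add_conj z hz)
    rw [map_sub]
    linear_combination this
  have hu := H₁.analytic_h.sub H₂.analytic_h
  have hv := H₁.analytic_g.sub H₂.analytic_g
  obtain ⟨c, hc⟩ := ((hu.add hv).analyticOnNhd isOpen_unitDisk).eq_const_of_re_eq_const (c₀ := 0)
    (fun z hz => by
      simp only [Pi.add_apply, Pi.sub_apply, key z hz]
      simp) isOpen_unitDisk hconn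
  obtain ⟨d, hd⟩ := ((hu.sub hv).analyticOnNhd isOpen_unitDisk).eq_const_of_im_eq_const (c₀ := 0)
    (fun z hz => by
      simp only [Pi.sub_apply, key z hz]
      simp
      ring) isOpen_unitDisk hconn
  simp only [Pi.add_apply, Pi.sub_apply] at hc hd
  have hg : Set.EqOn g₁ g₂ unitDisk := by
    intro z hz
    have h1 := hc z hz
    have h2 := hd z hz
    have h3 := hc 0 zero_mem_unitDisk
    have h4 := hd 0 zero_mem_unitDisk
    rw [H₁.g_zero, H₂.g_zero] at h3 h4
    linear_combination (h1 - h2 - h3 + h4) / 2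
  refine ⟨fun z hz => ?_, hg⟩
  have := key z hz
  rw [hg hz] at this
  simpa [sub_eq_zero] using this

end UnivalentHarmonic

/-! ### The shear construction -/

namespace UnivalentHarmonic

open Complex

/-- The real-linear map `v ↦ a v + conj (b v)`. -/
noncomputable def wirtingerMap (a b : ℂ) : ℂ →L[ℝ] ℂ :=
  (ContinuousLinearMap.toSpanSingleton ℂ a).restrictScalars ℝ +
    (conjCLE : ℂ →L[ℝ] ℂ).comp ((ContinuousLinearMap.toSpanSingleton ℂ b).restrictScalars ℝ)

lemma wirtingerMap_apply (a b v : ℂ) :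
    wirtingerMap a b v = a * v + (starRingEnd ℂ) (b * v) := by
  simp [wirtingerMap, mul_comm]

lemma wirtingerMap_injective {a b : ℂ} (hab : 0 < ‖a‖ ^ 2 - ‖b‖ ^ 2) :
    Function.Injective (wirtingerMap a b) := by
  rw [injective_iff_map_eq_zero]
  intro v hv
  rw [wirtingerMap_apply] at hv
  have h1 : ‖a * v‖ = ‖b * v‖ := by
    rw [eq_neg_of_add_eq_zero_left hv, norm_neg, RCLike.norm_conj]
  rw [norm_mul, norm_mul] at h1
  by_contra hne
  have := mul_right_cancel₀ (norm_ne_zero_iff.2 hne) h1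
  rw [this] at hab
  simp at hab

/-- The equivalence underlying `wirtingerMap` when the Jacobian is positive. -/
noncomputable def wirtingerEquiv {a b : ℂ} (hab : 0 < ‖a‖ ^ 2 - ‖b‖ ^ 2) : ℂ ≃L[ℝ] ℂ :=
  (LinearEquiv.ofInjectiveEndo (wirtingerMap a b : ℂ →ₗ[ℝ] ℂ)
    (wirtingerMap_injective hab)).toContinuousLinearEquiv

lemma coe_wirtingerEquiv {a b : ℂ} (hab : 0 < ‖a‖ ^ 2 - ‖b‖ ^ 2) :
    (wirtingerEquiv hab : ℂ →L[ℝ] ℂ) = wirtingerMap a b := by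
  ext
  simp [wirtingerEquiv]

section

variable {h g : ℂ → ℂ}

lemma hasStrictFDerivAt_add_conj (hh : DifferentiableOn ℂ h unitDisk)
    (hg : DifferentiableOn ℂ g unitDisk) {z : ℂ} (hz : z ∈ unitDisk) :
    HasStrictFDerivAt (fun z => h z + (starRingEnd ℂ) (g z))
      (wirtingerMap (deriv h z) (deriv g z)) z := by
  have h1 := (hh.analyticAt (isOpen_unitDisk.mem_nhds hz)).hasStrictDerivAt
  have h2 := (hg.analyticAt (isOpen_unitDisk.mem_nhds hz)).hasStrictDerivAt
  exact (h1.hasStrictFDerivAt.restrictScalars ℝ).add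
    ((conjCLE : ℂ →L[ℝ] ℂ).hasStrictFDerivAt.comp z (h2.hasStrictFDerivAt.restrictScalars ℝ))

/-- A univalent sense-preserving harmonic mapping is a homeomorphism onto its image. -/
lemma exists_openPartialHomeomorph (hh : DifferentiableOn ℂ h unitDisk)
    (hg : DifferentiableOn ℂ g unitDisk)
    (hinj : Set.InjOn (fun z => h z + (starRingEnd ℂ) (g z)) unitDisk)
    (hpos : ∀ z ∈ unitDisk, 0 < ‖deriv h z‖ ^ 2 - ‖deriv g z‖ ^ 2) :
    ∃ e : OpenPartialHomeomorph ℂ ℂ, e.source = unitDisk ∧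
      e.target = (fun z => h z + (starRingEnd ℂ) (g z)) '' unitDisk ∧
      ∀ z, e z = h z + (starRingEnd ℂ) (g z) := by
  have hd := fun z hz => hasStrictFDerivAt_add_conj hh hg (z := z) hz
  refine ⟨OpenPartialHomeomorph.ofContinuousOpenRestrict (hinj.bijOn_image.toPartialEquiv _ _ _ )
    (fun z hz => (hd z hz).hasFDerivAt.continuousAt.continuousWithinAt) ?_ isOpen_unitDisk,
    rfl, rfl, fun z => rfl⟩
  rw [isOpenMap_iff_nhds_le]
  rintro ⟨z, hz⟩
  have h1 := hd z hz
  rw [← coe_wirtingerEquiv (hpos z hz)] at h1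
  have h2 := h1.map_nhds_eq_of_equiv
  have h3 := map_nhds_subtype_coe_eq_nhds hz (isOpen_unitDisk.mem_nhds hz)
  rw [← h3, Filter.map_map] at h2
  exact h2.ge

/-- Clunie and Sheil-Small's shear construction: if `h + conj g` is univalent, sense-preserving and
convex in the imaginary direction, then so is `h + g`. -/
theorem shear (hh : DifferentiableOn ℂ h unitDisk)
    (hg : DifferentiableOn ℂ g unitDisk)
    (hinj : Set.InjOn (fun z => h z + (starRingEnd ℂ) (g z)) unitDisk)
    (hpos : ∀ z ∈ unitDisk, 0 < ‖deriv h z‖ ^ 2 - ‖deriv g z‖ ^ 2)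
    (hconv : IsConvexInImaginaryDirection fun z => h z + (starRingEnd ℂ) (g z)) :
    Set.InjOn (fun z => h z + g z) unitDisk ∧
      ∀ z₁ ∈ unitDisk, ∀ z₂ ∈ unitDisk, (h z₁ + g z₁).re = (h z₂ + g z₂).re →
        ∀ y ∈ Set.Icc (h z₁ + g z₁).im (h z₂ + g z₂).im,
          ∃ z ∈ unitDisk, h z + g z = (h z₁ + g z₁).re + y * I := by
  obtain ⟨e, hsrc, htgt, he⟩ := exists_openPartialHomeomorph hh hg hinj hpos
  have hre : ∀ z, (e z).re = (h z + g z).re := fun z => by rw [he]; simp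
  let S : ℝ → Set ℝ := fun u => {v | (u + v * I : ℂ) ∈ e.target}
  have hS : ∀ u, IsPreconnected (S u) := by
    intro u
    have h1 := (hconv u).image Complex.im Complex.continuous_im.continuousOn
    convert h1 using 1
    ext v
    have hexp : Complex.exp (((Real.pi / 2 : ℝ) : ℂ) * I) = I := by
      push_cast; exact Complex.exp_pi_div_two_mul_I
    rw [hexp, ← htgt]
    constructor
    · intro hv
      exact ⟨u + v * I, ⟨⟨v, rfl⟩, hv⟩, by simp⟩
    · rintro ⟨w, ⟨⟨t, rfl⟩, ht⟩, rfl⟩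
      simpa [S] using ht
  let γ : ℝ → ℝ → ℂ := fun u v => e.symm (u + v * I)
  -- Since f and h + g have the same real part, h + g carries the preimage of the line Re = u into
  -- that same line; `m u` records its height there.
  let m : ℝ → ℝ → ℝ := fun u v => (h (γ u v) + g (γ u v)).im
  have hγ : ∀ u, ∀ v ∈ S u, γ u v ∈ unitDisk := fun u v hv => hsrc ▸ e.map_target hv
  have heγ : ∀ u, ∀ v ∈ S u, e (γ u v) = u + v * I := fun u v hv => e.right_inv hv
  have hγe : ∀ z ∈ unitDisk, γ (e z).re (e z).im = z := fun z hz => by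
    simp only [γ, Complex.re_add_im]
    exact e.left_inv (hsrc ▸ hz)
  have hmemS : ∀ z ∈ unitDisk, (e z).im ∈ S (e z).re := fun z hz => by
    simp only [S, Set.mem_ofPred_eq, Complex.re_add_im]
    exact e.map_source (hsrc ▸ hz)
  have hm : ∀ u, ∀ v ∈ S u, ∃ d, d ≠ 0 ∧ HasDerivAt (m u) d v := by
    intro u v hv
    set z := γ u v with hzdef
    have hz := hγ u v hv
    have h1 := (hasStrictFDerivAt_add_conj hh hg hz).hasFDerivAt
    rw [← coe_wirtingerEquiv (hpos _ hz)] at h1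
    have hee : (fun z => h z + (starRingEnd ℂ) (g z)) = e := funext fun z => (he z).symm
    rw [hee] at h1
    have h2 := e.hasFDerivAt_symm hv h1
    have h3 : HasDerivAt (fun v : ℝ => (u + v * I : ℂ)) I v := by
      simpa using ((hasDerivAt_id (v : ℂ)).comp_ofReal.mul_const I).const_add (u : ℂ)
    have h4 := h2.comp_hasDerivAt v h3
    set k : ℂ := (wirtingerEquiv (hpos _ hz)).symm I with hk
    have h4 : HasDerivAt (γ u) k v := h4
    have hFd : HasDerivAt (fun z => h z + g z) (deriv h z + deriv g z) z :=
      (hh.differentiableAt (isOpen_unitDisk.mem_nhds hz)).hasDerivAt.add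
        (hg.differentiableAt (isOpen_unitDisk.mem_nhds hz)).hasDerivAt
    have h5 : HasDerivAt (fun v => h (γ u v) + g (γ u v)) ((deriv h z + deriv g z) * k) v :=
      HasDerivAt.comp v (h := γ u) (h₂ := fun z => h z + g z) hFd h4
    have hk' : deriv h z * k + (starRingEnd ℂ) (deriv g z * k) = I := by
      rw [← wirtingerMap_apply, ← coe_wirtingerEquiv (hpos _ hz)]
      exact (wirtingerEquiv (hpos _ hz)).apply_symm_apply I
    refine ⟨((deriv h z + deriv g z) * k).im, fun him => ?_,
      (Complex.imCLM.hasFDerivAt.comp_hasDerivAt v h5)⟩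
    -- The real part of (h' + g') k equals that of Df(k) = i. A zero derivative of `m u` would thus
    -- force (h' + g') k = 0, although |h'| > |g'| and k ≠ 0.
    have hre0 : ((deriv h z + deriv g z) * k).re = 0 := by
      have := congrArg Complex.re hk'
      rw [add_mul]
      simpa using this
    have h0 : (deriv h z + deriv g z) * k = 0 := Complex.ext hre0 him
    rcases mul_eq_zero.1 h0 with h0 | h0
    · have hp := hpos _ hz
      rw [eq_neg_of_add_eq_zero_left h0, norm_neg] at hp
      simp at hp
      exact lt_irrefl _ hp
    · rw [h0] at hk'
      simp at hk'
      exact Complex.I_ne_zero hk'.symm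
  have hmc : ∀ u, ContinuousOn (m u) (S u) := fun u v hv =>
    (hm u v hv).choose_spec.2.continuousAt.continuousWithinAt
  have hminj : ∀ u, ∀ v₁ ∈ S u, ∀ v₂ ∈ S u, v₁ < v₂ → m u v₁ ≠ m u v₂ := by
    intro u v₁ h₁ v₂ h₂ hlt heq
    have hsub : Set.Icc v₁ v₂ ⊆ S u := (hS u).ordConnected.out h₁ h₂
    have hsub' : ∀ v ∈ Set.Ioo v₁ v₂, v ∈ S u := fun v hv => hsub (Set.Ioo_subset_Icc_self hv)
    choose! d hd0 hd using hm u
    obtain ⟨v, hv, hv0⟩ := exists_hasDerivAt_eq_zero hlt ((hmc u).mono hsub) heq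
      (fun v hv => hd v (hsub' v hv))
    exact hd0 v (hsub' v hv) hv0
  have hmz : ∀ z ∈ unitDisk, m (e z).re (e z).im = (h z + g z).im := fun z hz => by
    simp only [m, hγe z hz]
  constructor
  · intro z₁ h₁ z₂ h₂ heq
    have heq : h z₁ + g z₁ = h z₂ + g z₂ := heq
    have hu : (e z₁).re = (e z₂).re := by rw [hre, hre, heq]
    have hm₁ := hmz z₁ h₁
    have hm₂ := hmz z₂ h₂
    have hs₁ := hmemS z₁ h₁
    have hs₂ := hmemS z₂ h₂
    rw [hu] at hm₁ hs₁
    have hmm : m (e z₂).re (e z₁).im = m (e z₂).re (e z₂).im := by rw [hm₁, hm₂, heq]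
    have hv : (e z₁).im = (e z₂).im := by
      rcases lt_trichotomy (e z₁).im (e z₂).im with hlt | hlt | hlt
      · exact (hminj _ _ hs₁ _ hs₂ hlt hmm).elim
      · exact hlt
      · exact (hminj _ _ hs₂ _ hs₁ hlt hmm.symm).elim
    exact e.injOn (hsrc ▸ h₁) (hsrc ▸ h₂) (Complex.ext hu hv)
  · intro z₁ h₁ z₂ h₂ heq y hy
    have hu : (e z₁).re = (e z₂).re := by rw [hre, hre, heq]
    have hs₁ := hmemS z₁ h₁
    have hs₂ := hmemS z₂ h₂
    rw [← hmz z₁ h₁, ← hmz z₂ h₂, ← hu] at hy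
    rw [← hu] at hs₂
    obtain ⟨v, hv, rfl⟩ := ((hS (e z₁).re).image _ (hmc _)).ordConnected.out
      (Set.mem_image_of_mem _ hs₁) (Set.mem_image_of_mem _ hs₂) hy
    refine ⟨γ (e z₁).re v, hγ _ _ hv, Complex.ext ?_ ?_⟩
    · rw [← hre, heγ _ _ hv, ← hre]
      simp
    · simp [m]

end

end UnivalentHarmonic

/-! ### Moving planes: z F'(z) is typically real -/

namespace UnivalentHarmonic

open Complex Filter Topology

lemma nonpos_of_hasDerivAt_of_le {N : ℝ → ℝ} {d δ : ℝ} (hδ : 0 < δ) (hN : HasDerivAt N d 0)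
    (hle : ∀ s, 0 < s → s < δ → N s ≤ N 0) : d ≤ 0 := by
  have h := (hasDerivWithinAt_iff_tendsto_slope' (s := Set.Ioi (0 : ℝ)) (by simp)).1
    (hN.hasDerivWithinAt (s := Set.Ioi (0 : ℝ)))
  refine le_of_tendsto h ?_
  filter_upwards [Ioo_mem_nhdsGT hδ] with s hs
  rw [slope_def_field, sub_zero]
  exact div_nonpos_of_nonpos_of_nonneg (by linarith [hle s hs.1 hs.2]) hs.1.le

/-- A univalent function on the disk with real coefficients whose image is convex in the imaginary
direction. -/
structure IsRealVerticallyConvex (F : ℂ → ℂ) : Prop where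
  differentiableOn : DifferentiableOn ℂ F unitDisk
  injOn : Set.InjOn F unitDisk
  deriv_ne_zero : ∀ z ∈ unitDisk, deriv F z ≠ 0
  map_zero : F 0 = 0
  deriv_zero : deriv F 0 = 1
  map_conj : ∀ z ∈ unitDisk, F ((starRingEnd ℂ) z) = (starRingEnd ℂ) (F z)
  convex : ∀ z₁ ∈ unitDisk, ∀ z₂ ∈ unitDisk, (F z₁).re = (F z₂).re →
    ∀ y ∈ Set.Icc (F z₁).im (F z₂).im, ∃ z ∈ unitDisk, F z = (F z₁).re + y * I

namespace IsRealVerticallyConvex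

variable {F : ℂ → ℂ}

lemma hasDerivAt (h : IsRealVerticallyConvex F) {z : ℂ} (hz : z ∈ unitDisk) :
    HasDerivAt F (deriv F z) z :=
  (h.differentiableOn.differentiableAt (isOpen_unitDisk.mem_nhds hz)).hasDerivAt

/-- Injectivity and symmetry make F non-real off the real axis. The upper half disk is connected, so
Im F has one sign there, and F'(0) = 1 makes it positive. -/
lemma im_pos (h : IsRealVerticallyConvex F) {z : ℂ} (hz : z ∈ unitDisk) (him : 0 < z.im) :
    0 < (F z).im := by
  have hne : ∀ w ∈ unitDisk, 0 < w.im → (F w).im ≠ 0 := by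
    intro w hw hpos h0
    have : (starRingEnd ℂ) w = w := by
      refine h.injOn (conj_mem_unitDisk hw) hw ?_
      rw [h.map_conj w hw, Complex.conj_eq_iff_im.2 h0]
    rw [Complex.conj_eq_iff_im] at this
    exact hpos.ne' this
  by_contra hcon
  have hneg : (F z).im < 0 := lt_of_le_of_ne (not_lt.1 hcon) (hne z hz him)
  have hU : IsPreconnected (unitDisk ∩ {w : ℂ | 0 < w.im}) :=
    ((convex_ball (0 : ℂ) 1).inter (convex_halfSpace_im_gt 0)).isPreconnected
  have hcont : ContinuousOn (fun w => (F w).im) (unitDisk ∩ {w : ℂ | 0 < w.im}) :=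
    Complex.continuous_im.comp_continuousOn (h.differentiableOn.continuousOn.mono
      Set.inter_subset_left)
  have hd : HasDerivAt (fun s : ℝ => (F (s * I)).im) 1 0 := by
    have h1 : HasDerivAt (fun s : ℝ => (s * I : ℂ)) I 0 := by
      simpa using (hasDerivAt_id ((0 : ℝ) : ℂ)).comp_ofReal.mul_const I
    have h2 : HasDerivAt F 1 (((0 : ℝ) : ℂ) * I) := by
      have := h.hasDerivAt zero_mem_unitDisk
      rw [h.deriv_zero] at this
      simpa using this
    have h3 : HasDerivAt (fun s : ℝ => (F (s * I)).im) (1 * I).im 0 :=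
      Complex.imCLM.hasFDerivAt.comp_hasDerivAt (0 : ℝ)
        (HasDerivAt.comp (h₂ := F) (h := fun s : ℝ => (s * I : ℂ)) (0 : ℝ) h2 h1)
    simpa using h3
  have hall : ∀ w ∈ unitDisk, 0 < w.im → (F w).im ≤ 0 := by
    intro w hw hpos
    by_contra! hc
    obtain ⟨x, hx, hx0⟩ := hU.intermediate_value ⟨hz, him⟩ ⟨hw, hpos⟩ hcont ⟨hneg.le, hc.le⟩
    exact hne x hx.1 hx.2 hx0
  have := nonpos_of_hasDerivAt_of_le one_pos hd fun s hs0 hs1 => by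
    have hs : (s * I : ℂ) ∈ unitDisk := by
      simpa [mem_unitDisk, abs_of_pos hs0] using hs1
    have := hall _ hs (by simpa using hs0)
    simpa [h.map_zero] using this
  linarith

lemma exists_openPartialHomeomorph (h : IsRealVerticallyConvex F) :
    ∃ e : OpenPartialHomeomorph ℂ ℂ, e.source = unitDisk ∧ ∀ z, e z = F z := by
  obtain ⟨e, h1, -, h2⟩ := UnivalentHarmonic.exists_openPartialHomeomorph h.differentiableOn
    (differentiableOn_const 0) (by simpa using h.injOn) fun z hz => by
      simpa using pow_pos (norm_pos_iff.2 (h.deriv_ne_zero z hz)) 2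
  exact ⟨e, h1, by simpa using h2⟩

lemma exists_sub_mul_I (h : IsRealVerticallyConvex F) {z : ℂ} (hz : z ∈ unitDisk) {s : ℝ}
    (h0 : 0 ≤ s) (h1 : s ≤ 2 * (F z).im) : ∃ w ∈ unitDisk, F w = F z - s * I := by
  obtain ⟨w, hw, hFw⟩ := h.convex _ (conj_mem_unitDisk hz) z hz (by rw [h.map_conj z hz]; simp)
    ((F z).im - s) (by rw [h.map_conj z hz]; simp; constructor <;> linarith)
  refine ⟨w, hw, ?_⟩
  rw [hFw, h.map_conj z hz]
  apply Complex.ext <;> simp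

/-- Moving-plane comparison: reflecting an upper point of the image in a horizontal line brings it
closer to the origin in the sense of Green's function. -/
lemma norm_le_of_map_eq_sub (h : IsRealVerticallyConvex F) {z w : ℂ} (hz : z ∈ unitDisk)
    (hw : w ∈ unitDisk) {s : ℝ} (h0 : 0 < s) (h1 : s < 2 * (F z).im) (hwz : F w = F z - s * I) :
    ‖w‖ ≤ ‖z‖ := by
  obtain ⟨e, hsrc, he⟩ := h.exists_openPartialHomeomorph
  have hinv : ∀ x ∈ unitDisk, e.symm (F x) = x := fun x hx => by
    rw [← he]; exact e.left_inv (hsrc ▸ hx)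
  have hsymm : ∀ x ∈ unitDisk, HasDerivAt e.symm (deriv F x)⁻¹ (F x) := by
    intro x hx
    refine e.hasDerivAt_symm (by rw [← he]; exact e.map_source (hsrc ▸ hx)) (h.deriv_ne_zero x hx) ?_
    rw [hinv x hx, show (e : ℂ → ℂ) = F from funext he]
    exact h.hasDerivAt hx
  -- The maximum principle is applied to φ on the part of |x| < r where Im F > s/2. This region
  -- avoids the origin because F(0) = 0.
  let φ : ℂ → ℂ := fun x => e.symm (F x - s * I) / x
  have hz0 : z ≠ 0 := by
    rintro rfl
    rw [h.map_zero] at h1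
    simp at h1
    linarith
  have hφ : ∀ r, ‖z‖ < r → r < 1 → ‖φ z‖ ≤ 1 / r := by
    intro r hzr hr
    have hr0 : 0 < r := (norm_nonneg z).trans_lt hzr
    have hball : Metric.closedBall (0 : ℂ) r ⊆ unitDisk := Metric.closedBall_subset_ball hr
    have hcont : ContinuousOn (fun x => (F x).im) (Metric.closedBall 0 r) :=
      Complex.continuous_im.comp_continuousOn (h.differentiableOn.continuousOn.mono hball)
    set K : Set ℂ := Metric.closedBall 0 r ∩ (fun x => (F x).im) ⁻¹' Set.Ici (s / 2) with hK
    set U : Set ℂ := Metric.ball 0 r ∩ (fun x => (F x).im) ⁻¹' Set.Ioi (s / 2) with hU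
    have hKc : IsClosed K := hcont.preimage_isClosed_of_isClosed Metric.isClosed_closedBall
      isClosed_Ici
    have hUo : IsOpen U := (hcont.mono Metric.ball_subset_closedBall).isOpen_inter_preimage
      Metric.isOpen_ball isOpen_Ioi
    have hcl : closure U ⊆ K := closure_minimal (fun x hx =>
      ⟨Metric.ball_subset_closedBall hx.1, Set.preimage_mono Set.Ioi_subset_Ici_self hx.2⟩) hKc
    have hKim : ∀ x ∈ K, s / 2 ≤ (F x).im := fun x hx => hx.2
    have hK0 : ∀ x ∈ K, x ≠ 0 := by
      rintro x hx rfl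
      have := hKim _ hx
      rw [h.map_zero] at this
      simp at this
      linarith
    refine Complex.norm_le_of_forall_mem_frontier_norm_le (U := U)
      (Metric.isBounded_ball.subset Set.inter_subset_left) (f := φ) ?_ ?_ (subset_closure ?_)
    · refine DifferentiableOn.diffContOnCl fun x hx => ?_
      have hxK := hcl hx
      obtain ⟨y, hy, hFy⟩ := h.exists_sub_mul_I (hball hxK.1) h0.le (by linarith [hKim x hxK])
      have hd : HasDerivAt e.symm (deriv F y)⁻¹ (F x - s * I) := hFy ▸ hsymm y hy
      exact ((HasDerivAt.comp x (h₂ := e.symm) hd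
        ((h.hasDerivAt (hball hxK.1)).sub_const (s * I))).differentiableAt.div differentiableAt_id
          (hK0 x hxK)).differentiableWithinAt
    · intro x hx
      rw [frontier, hUo.interior_eq] at hx
      have hxK := hcl hx.1
      have hxD := hball hxK.1
      have hxr : ‖x‖ ≤ r := by simpa using hxK.1
      have hx0 : 0 < ‖x‖ := norm_pos_iff.2 (hK0 x hxK)
      obtain ⟨y, hy, hFy⟩ := h.exists_sub_mul_I hxD h0.le (by linarith [hKim x hxK])
      have hyx : φ x = y / x := by simp only [φ]; rw [← hFy, hinv y hy]
      rw [hyx, norm_div]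
      by_cases hxr' : ‖x‖ < r
      -- On the reflecting line F(x) - is is the conjugate of F(x), so y is the conjugate of x and
      -- |φ| = 1.
      · have him : (F x).im = s / 2 := by
          refine le_antisymm ?_ (hKim x hxK)
          by_contra! hc
          exact hx.2 ⟨by simpa using hxr', hc⟩
        have : y = (starRingEnd ℂ) x := by
          refine h.injOn hy (conj_mem_unitDisk hxD) ?_
          rw [hFy, h.map_conj x hxD]
          apply Complex.ext
          · simp
          · simp; linarith
        rw [this, RCLike.norm_conj, div_self hx0.ne', le_div_iff₀ hr0]
        linarith
      · have hxe : ‖x‖ = r := le_antisymm hxr (not_lt.1 hxr')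
        rw [hxe]
        exact div_le_div_of_nonneg_right (mem_unitDisk.1 hy).le hr0.le
    · exact ⟨by simpa using hzr, by simp only [Set.mem_preimage, Set.mem_Ioi]; linarith⟩
  have hwφ : φ z = w / z := by simp only [φ]; rw [← hwz, hinv w hw]
  rw [hwφ] at hφ
  have hz1 := mem_unitDisk.1 hz
  have hzpos : 0 < ‖z‖ := norm_pos_iff.2 hz0
  by_contra! hlt
  have hw1 := mem_unitDisk.1 hw
  have hq : ‖z‖ / ‖w‖ < 1 := (div_lt_one (hzpos.trans hlt)).2 hlt
  -- With r > |z| / |w| the bound |w| / |z| ≤ 1 / r fails.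
  obtain ⟨r, hr, hr1⟩ := exists_between (max_lt hz1 hq)
  have hr0 : 0 < r := hzpos.trans ((le_max_left _ _).trans_lt hr)
  have h2 := hφ r ((le_max_left _ _).trans_lt hr) hr1
  have h3 := (div_lt_iff₀ (hzpos.trans hlt)).1 ((le_max_right _ _).trans_lt hr)
  rw [norm_div, div_le_div_iff₀ hzpos hr0] at h2
  linarith

/-- By the comparison, |F⁻¹(F(z) - is)|² is at most |z|² for small s > 0. Its derivative at s = 0 is
-2 Im(z F'(z)) / |F'(z)|². -/
lemma im_mul_deriv_nonneg_of_im_pos (h : IsRealVerticallyConvex F) {z : ℂ} (hz : z ∈ unitDisk)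
    (him : 0 < z.im) : 0 ≤ (z * deriv F z).im := by
  obtain ⟨e, hsrc, he⟩ := h.exists_openPartialHomeomorph
  have hinv : ∀ x ∈ unitDisk, e.symm (F x) = x := fun x hx => by
    rw [← he]; exact e.left_inv (hsrc ▸ hx)
  have hsymm : HasDerivAt e.symm (deriv F z)⁻¹ (F z) := by
    refine e.hasDerivAt_symm (by rw [← he]; exact e.map_source (hsrc ▸ hz)) (h.deriv_ne_zero z hz) ?_
    rw [hinv z hz, show (e : ℂ → ℂ) = F from funext he]
    exact h.hasDerivAt hz
  let c : ℝ → ℂ := fun s => e.symm (F z - s * I)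
  have hc0 : c 0 = z := by simp [c, hinv z hz]
  have hc : HasDerivAt c (-((deriv F z)⁻¹ * I)) 0 := by
    have h1 : HasDerivAt (fun s : ℝ => (F z - s * I : ℂ)) (-I) 0 := by
      simpa using ((hasDerivAt_id ((0 : ℝ) : ℂ)).comp_ofReal.mul_const I).const_sub (F z)
    have h2 : HasDerivAt e.symm (deriv F z)⁻¹ (F z - (0 : ℝ) * I) := by simpa using hsymm
    have h3 : HasDerivAt c ((deriv F z)⁻¹ * -I) 0 :=
      HasDerivAt.comp (h₂ := e.symm) (h := fun s : ℝ => (F z - s * I : ℂ)) (0 : ℝ) h2 h1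
    rwa [mul_neg] at h3
  have hre : HasDerivAt (fun s => (c s).re) (-((deriv F z)⁻¹ * I)).re 0 :=
    Complex.reCLM.hasFDerivAt.comp_hasDerivAt (0 : ℝ) hc
  have hIm : HasDerivAt (fun s => (c s).im) (-((deriv F z)⁻¹ * I)).im 0 :=
    Complex.imCLM.hasFDerivAt.comp_hasDerivAt (0 : ℝ) hc
  have hN : HasDerivAt (fun s => (c s).re ^ 2 + (c s).im ^ 2)
      (2 * z.re * (-((deriv F z)⁻¹ * I)).re + 2 * z.im * (-((deriv F z)⁻¹ * I)).im) 0 := by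
    refine ((hre.fun_pow 2).fun_add (hIm.fun_pow 2)).congr_deriv ?_
    simp [hc0]
  have hle := nonpos_of_hasDerivAt_of_le (δ := 2 * (F z).im) (by linarith [h.im_pos hz him]) hN
    fun s hs0 hs1 => by
      obtain ⟨w, hw, hFw⟩ := h.exists_sub_mul_I hz hs0.le hs1.le
      have hwc : c s = w := by simp only [c]; rw [← hFw, hinv w hw]
      have hn := h.norm_le_of_map_eq_sub hz hw hs0 hs1 hFw
      have hn2 := pow_le_pow_left₀ (norm_nonneg w) hn 2
      rw [Complex.sq_norm, Complex.sq_norm, Complex.normSq_apply, Complex.normSq_apply] at hn2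
      rw [hwc, hc0]
      linarith
  have hd0 : 0 < Complex.normSq (deriv F z) := Complex.normSq_pos.2 (h.deriv_ne_zero z hz)
  simp only [Complex.neg_re, Complex.neg_im, Complex.mul_re, Complex.mul_im, Complex.inv_re,
    Complex.inv_im, Complex.I_re, Complex.I_im] at hle
  have hkey : 0 ≤ (2 * (z * deriv F z).im) / Complex.normSq (deriv F z) := by
    refine le_of_le_of_eq (neg_nonneg.2 hle) ?_
    rw [Complex.mul_im]
    field_simp
    ring
  rw [le_div_iff₀ hd0] at hkey
  linarith

/-- `z F'(z)` is typically real. -/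
theorem im_mul_im_nonneg (h : IsRealVerticallyConvex F)
    (hd : ∀ z ∈ unitDisk, deriv F ((starRingEnd ℂ) z) = (starRingEnd ℂ) (deriv F z))
    {z : ℂ} (hz : z ∈ unitDisk) : 0 ≤ z.im * (z * deriv F z).im := by
  rcases lt_trichotomy z.im 0 with hlt | heq | hgt
  · have := h.im_mul_deriv_nonneg_of_im_pos (conj_mem_unitDisk hz) (by simpa using hlt)
    rw [hd z hz, ← map_mul, Complex.conj_im] at this
    exact mul_nonneg_of_nonpos_of_nonpos hlt.le (by linarith)
  · rw [heq, zero_mul]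
  · exact mul_nonneg hgt.le (h.im_mul_deriv_nonneg_of_im_pos hz hgt)

end IsRealVerticallyConvex

end UnivalentHarmonic

/-! ### From positive real part to integer recursions -/

namespace UnivalentHarmonic

open Complex Filter Topology

/-- Coefficients of `(1 - z ^ 2) * u (r * z)` in terms of the coefficients `c` of `u`. -/
noncomputable def dilatedCoeff (c : ℕ → ℝ) (r : ℝ) (n : ℕ) : ℝ :=
  c n * r ^ n - if 2 ≤ n then c (n - 2) * r ^ (n - 2) else 0

lemma continuous_cosMoment_dilatedCoeff (c : ℕ → ℝ) (n : ℕ) :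
    Continuous fun r => cosMoment (dilatedCoeff c r) n := by
  unfold cosMoment dilatedCoeff
  split_ifs <;> fun_prop

theorem IsRealVerticallyConvex.exists_isAdmissible {F : ℂ → ℂ} (h : IsRealVerticallyConvex F)
    {α : ℕ → ℤ} (hα : ∀ n, taylorCoeff F n = (α n : ℂ) / 2) : ∃ t, IsAdmissible α t := by
  set c : ℕ → ℝ := fun n => (n + 1) * (α (n + 1) / 2) with hc
  have hcF : ∀ n, taylorCoeff (deriv F) n = c n := fun n => by
    rw [taylorCoeff_deriv, hα, hc]; push_cast; rfl
  have hdF : DifferentiableOn ℂ (deriv F) unitDisk := h.differentiableOn.deriv isOpen_unitDisk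
  have hα1 : α 1 = 2 := by
    have := hα 1
    rw [taylorCoeff_one, h.deriv_zero] at this
    have h2 : ((α 1 : ℤ) : ℂ) = (2 : ℤ) := by push_cast; linear_combination -2 * this
    exact_mod_cast h2
  refine ⟨cosMoment (dilatedCoeff c 1), ?_, ?_, hα1, ?_⟩
  · refine IsToeplitzNonneg.of_tendsto (T := fun r => cosMoment (dilatedCoeff c r)) ?_ fun n =>
      ((continuous_cosMoment_dilatedCoeff c n).tendsto 1).mono_left nhdsWithin_le_nhds
    intro r hr0 hr1
    have hs1 := summable_abs_mul_pow hdF hcF hr0.le hr1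
    refine isToeplitzNonneg_cosMoment ?_ fun θ => ?_
    · refine Summable.abs (f := dilatedCoeff c r) ?_
      refine hs1.of_abs.sub ((summable_nat_add_iff 2).1 ?_)
      simpa using hs1.of_abs
    · have H1 := hasSum_cos hdF hcF hr0.le hr1 θ 1 0 (by simp)
      have H2 := hasSum_cos hdF hcF hr0.le hr1 θ (Complex.exp ((2 : ℕ) * θ * I)) 2 rfl
      have H3 : HasSum (fun n : ℕ =>
          (if 2 ≤ n then c (n - 2) * r ^ (n - 2) else 0) * Real.cos (n * θ))
          (Complex.exp ((2 : ℕ) * θ * I) * deriv F (r * Complex.exp (θ * I))).re := by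
        generalize (Complex.exp ((2 : ℕ) * θ * I) * deriv F (r * Complex.exp (θ * I))).re = W at H2 ⊢
        refine (hasSum_nat_add_iff' 2).1 ?_
        simpa [Finset.sum_range_succ] using H2
      have H4 : HasSum (fun n => dilatedCoeff c r n * Real.cos (n * θ))
          ((1 * deriv F (r * Complex.exp (θ * I))).re -
            (Complex.exp ((2 : ℕ) * θ * I) * deriv F (r * Complex.exp (θ * I))).re) := by
        exact (H1.sub H3).congr_fun fun n => by rw [dilatedCoeff, sub_mul, add_zero]
      rw [H4.tsum_eq]
      set E := Complex.exp (θ * I) with hE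
      set z : ℂ := r * E with hz
      have hzD : z ∈ unitDisk := by
        rw [mem_unitDisk, hz, norm_mul, Complex.norm_exp_ofReal_mul_I, Complex.norm_real,
          Real.norm_eq_abs, abs_of_pos hr0, mul_one]
        exact hr1
      have hpos := h.im_mul_im_nonneg
        (fun w hw => map_conj_of_real_taylorCoeff hdF hcF hw) hzD
      have hE2 : Complex.exp ((2 : ℕ) * θ * I) = E * E := by
        rw [hE, ← Complex.exp_add]; push_cast; ring_nf
      have hre : E.re = Real.cos θ := Complex.exp_ofReal_mul_I_re θ
      have him : E.im = Real.sin θ := Complex.exp_ofReal_mul_I_im θ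
      rw [hE2]
      -- On |z| = r one has 1 - E² = -2i sin θ · E. Using E² rather than z² makes this identity
      -- exact for every r.
      have key : r ^ 2 * ((1 * deriv F z).re - (E * E * deriv F z).re) =
          2 * (z.im * (z * deriv F z).im) := by
        have hcs := Real.sin_sq_add_cos_sq θ
        simp only [Complex.mul_re, Complex.mul_im, hz, hre, him, Complex.ofReal_re,
          Complex.ofReal_im, Complex.one_re, Complex.one_im]
        linear_combination (-r ^ 2 * (deriv F (r * E)).re) * hcs
      refine nonneg_of_mul_nonneg_right (a := r ^ 2) ?_ (by positivity)
      rw [key]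
      positivity
  · simp [cosMoment, dilatedCoeff, hc, hα1]
  · intro k
    rcases k with _ | k
    · simp [cosMoment, dilatedCoeff, hc]
      ring
    · simp [cosMoment, dilatedCoeff, hc]
      ring_nf

/-- Q = (h' - g') / (h' + g') has nonnegative real part because |h'| > |g'|. Comparing coefficients
in Q (h' + g') = h' - g' gives the convolution; the halving in `cosMoment` absorbs the 1/2 in the
coefficients of h' + g'. -/
theorem exists_isShearPair {h g : ℂ → ℂ} (hh : DifferentiableOn ℂ h unitDisk)
    (hg : DifferentiableOn ℂ g unitDisk)
    (hpos : ∀ z ∈ unitDisk, 0 < ‖deriv h z‖ ^ 2 - ‖deriv g z‖ ^ 2)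
    {a b : ℕ → ℤ} (ha : ∀ n, taylorCoeff h n = (a n : ℂ) / 2)
    (hb : ∀ n, taylorCoeff g n = (b n : ℂ) / 2) (ha1 : a 1 = 2) (hb1 : b 1 = 0) :
    ∃ s, IsShearPair (fun n => a n + b n) b s := by
  have hh' : DifferentiableOn ℂ (deriv h) unitDisk := hh.deriv isOpen_unitDisk
  have hg' : DifferentiableOn ℂ (deriv g) unitDisk := hg.deriv isOpen_unitDisk
  have hne : ∀ z ∈ unitDisk, deriv h z + deriv g z ≠ 0 := by
    intro z hz h0
    have := hpos z hz
    rw [eq_neg_of_add_eq_zero_left h0, norm_neg] at this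
    simp at this
  let Q : ℂ → ℂ := fun z => (deriv h z - deriv g z) / (deriv h z + deriv g z)
  have hQ : DifferentiableOn ℂ Q unitDisk := (hh'.sub hg').div (hh'.add hg') hne
  let c : ℕ → ℝ := fun n => (n + 1) * ((a (n + 1) + b (n + 1)) / 2)
  let d : ℕ → ℝ := fun n => (n + 1) * ((a (n + 1) - b (n + 1)) / 2)
  have hc : ∀ n, taylorCoeff (fun z => deriv h z + deriv g z) n = c n := fun n => by
    rw [taylorCoeff_add hh' hg', taylorCoeff_deriv, taylorCoeff_deriv, ha, hb]
    simp only [c]; push_cast; ring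
  have hd : ∀ n, taylorCoeff (fun z => deriv h z - deriv g z) n = d n := fun n => by
    rw [taylorCoeff_sub hh' hg', taylorCoeff_deriv, taylorCoeff_deriv, ha, hb]
    simp only [d]; push_cast; ring
  have hc0 : c 0 = 1 := by simp [c, ha1, hb1]
  have hd0 : d 0 = 1 := by simp [d, ha1, hb1]
  have hprod : ∀ n, ∑ i ∈ Finset.range (n + 1), taylorCoeff Q i * (c (n - i) : ℂ) = d n := by
    intro n
    rw [← hd n, ← taylorCoeff_congr (u := fun z => Q z * (deriv h z + deriv g z))
      (fun z hz => div_mul_cancel₀ _ (hne z hz)), taylorCoeff_mul (v := fun z => deriv h z + deriv g z) hQ (hh'.add hg')]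
    exact Finset.sum_congr rfl fun i _ => by rw [← hc]
  -- The recursion has real data and leading coefficient 1, so Q has real coefficients.
  have hreal : ∀ n, (taylorCoeff Q n).im = 0 := by
    intro n
    induction n using Nat.strong_induction_on with
    | _ n ih =>
      have := congrArg Complex.im (hprod n)
      rw [Finset.sum_range_succ, Nat.sub_self, hc0, Complex.add_im, Complex.im_sum,
        Finset.sum_eq_zero] at this
      · simpa using this
      · intro i hi
        rw [Complex.im_mul_ofReal, ih i (Finset.mem_range.1 hi), zero_mul]
  let q : ℕ → ℝ := fun n => (taylorCoeff Q n).re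
  have hq : ∀ n, taylorCoeff Q n = q n := fun n => Complex.ext rfl (hreal n)
  have hprod' : ∀ n, ∑ i ∈ Finset.range (n + 1), q i * c (n - i) = d n := by
    intro n
    have := hprod n
    simp only [hq] at this
    exact_mod_cast this
  have hq0 : q 0 = 1 := by simpa [hc0, hd0] using hprod' 0
  have hQpos : ∀ z ∈ unitDisk, 0 ≤ (Q z).re := by
    intro z hz
    have := hpos z hz
    rw [Complex.sq_norm, Complex.sq_norm, Complex.normSq_apply, Complex.normSq_apply] at this
    simp only [Q, Complex.div_re, Complex.sub_re, Complex.sub_im, Complex.add_re, Complex.add_im]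
    rw [← add_div]
    refine div_nonneg ?_ (Complex.normSq_nonneg _)
    linarith
  refine ⟨cosMoment q, ?_, by simp [cosMoment, hq0], ?_⟩
  · refine IsToeplitzNonneg.of_tendsto (T := fun r => cosMoment fun n => q n * r ^ n) ?_ fun n => ?_
    · intro r hr0 hr1
      refine isToeplitzNonneg_cosMoment (summable_abs_mul_pow hQ hq hr0.le hr1) fun θ => ?_
      have H1 := hasSum_cos hQ hq hr0.le hr1 θ 1 0 (by simp)
      simp only [add_zero, one_mul] at H1
      rw [H1.tsum_eq]
      refine hQpos _ ?_
      rw [mem_unitDisk, norm_mul, Complex.norm_exp_ofReal_mul_I, Complex.norm_real,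
        Real.norm_eq_abs, abs_of_pos hr0, mul_one]
      exact hr1
    · have hcont : Continuous fun r : ℝ => cosMoment (fun n => q n * r ^ n) n := by
        unfold cosMoment
        split_ifs <;> fun_prop
      have := (hcont.tendsto 1).mono_left (nhdsWithin_le_nhds (s := Set.Iio (1 : ℝ)))
      simpa using this
  · intro n
    have := hprod' n
    rw [Finset.sum_range_succ', hq0, Nat.sub_zero, one_mul] at this
    have h2 : ∑ i ∈ Finset.range n, cosMoment q (i + 1) *
        ((n - i : ℕ) * ((a (n - i) + b (n - i) : ℤ) : ℝ)) =
        ∑ i ∈ Finset.range n, q (i + 1) * c (n - (i + 1)) := by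
      refine Finset.sum_congr rfl fun i hi => ?_
      have hi' := Finset.mem_range.1 hi
      obtain ⟨k, hk⟩ : ∃ k, n - i = k + 1 := ⟨n - i - 1, by omega⟩
      rw [show n - (i + 1) = k by omega, hk]
      simp only [cosMoment, c, Nat.add_eq_zero_iff, one_ne_zero, and_false, if_false]
      push_cast
      ring
    rw [h2]
    simp only [c, d] at this ⊢
    linarith

/-! ### Summing the coefficient sequences -/

section ClosedForms

variable {u : ℂ → ℂ} {z : ℂ}

lemma one_sub_ne_zero (hz : z ∈ unitDisk) : 1 - z ≠ 0 := by
  intro h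
  rw [mem_unitDisk, ← sub_eq_zero.1 h] at hz
  simp at hz

lemma one_add_ne_zero (hz : z ∈ unitDisk) : 1 + z ≠ 0 := by
  intro h
  rw [mem_unitDisk, eq_neg_of_add_eq_zero_right h] at hz
  simp at hz

lemma one_sub_sq_ne_zero (hz : z ∈ unitDisk) : 1 - z ^ 2 ≠ 0 := by
  rw [show 1 - z ^ 2 = (1 - z) * (1 + z) by ring]
  exact mul_ne_zero (one_sub_ne_zero hz) (one_add_ne_zero hz)

/-- The two geometric series produce e/2 at even and o/2 at odd powers; the linear term restores the
coefficient 1 of z. -/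
lemma eq_of_even_odd_coeff (hu : DifferentiableOn ℂ u unitDisk) {α : ℕ → ℤ} {e o : ℤ}
    (hα : ∀ n, taylorCoeff u n = (α n : ℂ) / 2) (h0 : α 0 = 0) (h1 : α 1 = 2)
    (he : ∀ n, α (2 * n + 2) = e) (ho : ∀ n, α (2 * n + 3) = o) (hz : z ∈ unitDisk) :
    u z = (1 - o / 2) * z + (o + e) / 4 * (z / (1 - z)) + (o - e) / 4 * (z / (1 + z)) := by
  have hz1 := mem_unitDisk.1 hz
  have H1 := hasSum_ite_eq 1 z
  have H2 := (hasSum_geometric_of_norm_lt_one hz1).sub (hasSum_ite_eq 0 (1 : ℂ))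
  have H3 := (hasSum_ite_eq 0 (1 : ℂ)).sub
    (hasSum_geometric_of_norm_lt_one (ξ := -z) (by simpa using hz1))
  have e2 : (1 - z)⁻¹ - 1 = z / (1 - z) := by
    have := one_sub_ne_zero hz
    field_simp
    ring
  have e3 : 1 - (1 - -z)⁻¹ = z / (1 + z) := by
    have := one_add_ne_zero hz
    rw [sub_neg_eq_add]
    field_simp
    ring
  rw [e2] at H2
  rw [e3] at H3
  refine (hasSum_taylorCoeff hu hz).unique ?_
  have H := ((H1.mul_left (1 - o / 2 : ℂ)).add (H2.mul_left ((o + e) / 4 : ℂ))).add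
    (H3.mul_left ((o - e) / 4 : ℂ))
  have hfun : (fun n => taylorCoeff u n * z ^ n) = fun n =>
      (1 - o / 2 : ℂ) * (if n = 1 then z else 0) +
        (o + e) / 4 * (z ^ n - if n = 0 then 1 else 0) +
        (o - e) / 4 * ((if n = 0 then 1 else 0) - (-z) ^ n) := by
    funext n
    rw [hα]
    rcases n with _ | _ | n
    · simp [h0]
    · simp [h1]; ring
    · have hp : (-z) ^ (n + 1 + 1) = (-1) ^ n * z ^ (n + 1 + 1) := by
        rw [neg_pow]; ring
      rw [hp]
      rcases Nat.even_or_odd' n with ⟨m, rfl | rfl⟩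
      · rw [he m]
        simp
        ring
      · rw [show 2 * m + 1 + 1 + 1 = 2 * m + 3 by ring, ho m]
        simp [pow_succ]
        ring
  rw [hfun]
  exact H

lemma eq_of_geometric_coeff (hu : DifferentiableOn ℂ u unitDisk) {α : ℕ → ℤ} {ε : ℤ}
    (hε : ε = 1 ∨ ε = -1) (hα : ∀ n, taylorCoeff u n = (α n : ℂ) / 2) (h0 : α 0 = 0)
    (h : ∀ n, α (n + 1) = 2 * ε ^ n) (hz : z ∈ unitDisk) : u z = z / (1 - ε * z) := by
  have hz1 : ‖ε * z‖ < 1 := by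
    rcases hε with rfl | rfl <;> simpa using mem_unitDisk.1 hz
  have H := (hasSum_nat_add_iff' 1).2 (hasSum_taylorCoeff hu hz)
  simp only [Finset.range_one, Finset.sum_singleton, hα, h0, h] at H
  norm_num at H
  refine H.unique ?_
  have H' := (hasSum_geometric_of_norm_lt_one hz1).mul_left z
  rw [← div_eq_mul_inv] at H'
  refine H'.congr_fun fun n => ?_
  rw [mul_pow]
  ring

lemma eq_of_arithmetic_geometric_coeff (hu : DifferentiableOn ℂ u unitDisk) {β : ℕ → ℤ} {ε : ℤ}
    (hε : ε = 1 ∨ ε = -1) (hβ : ∀ n, taylorCoeff u n = (β n : ℂ) / 2) (h0 : β 0 = 0)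
    (h : ∀ n : ℕ, β (n + 1) = -n * ε ^ n) (hz : z ∈ unitDisk) :
    u z = -z / 2 * (ε * z / (1 - ε * z) ^ 2) := by
  have hz1 : ‖ε * z‖ < 1 := by
    rcases hε with rfl | rfl <;> simpa using mem_unitDisk.1 hz
  have H := (hasSum_nat_add_iff' 1).2 (hasSum_taylorCoeff hu hz)
  simp only [Finset.range_one, Finset.sum_singleton, hβ, h0, h] at H
  norm_num at H
  refine H.unique ?_
  refine ((hasSum_coe_mul_geometric_of_norm_lt_one hz1).mul_left (-z / 2)).congr_fun fun n => ?_
  rw [mul_pow]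
  ring

lemma eq_zero_of_coeff (hu : DifferentiableOn ℂ u unitDisk) (h : ∀ n, taylorCoeff u n = 0)
    (hz : z ∈ unitDisk) : u z = 0 := by
  have H := hasSum_taylorCoeff hu hz
  simp only [h, zero_mul] at H
  exact H.unique hasSum_zero

lemma exists_mem_setT5 (hu : DifferentiableOn ℂ u unitDisk) {α : ℕ → ℤ}
    (hα : ∀ n, taylorCoeff u n = (α n : ℂ) / 2) (h0 : α 0 = 0) (h1 : α 1 = 2)
    (hcl : IsAdmissible.Classified α) : ∃ F ∈ setT5, Set.EqOn u F unitDisk := by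
  obtain ⟨he, ho, hc⟩ := hcl
  have H := fun z (hz : z ∈ unitDisk) => eq_of_even_odd_coeff hu hα h0 h1 he ho hz
  rcases hc with ⟨h2, h3⟩ | ⟨h2, h3⟩ | ⟨h2, h3⟩ | ⟨h2, h3⟩ | ⟨h2, h3⟩ | ⟨h2, h3⟩ | ⟨h2, h3⟩ |
    ⟨h2, h3⟩ | ⟨h2, h3⟩
  all_goals rw [h2, h3] at H
  · refine ⟨fun z => z / (1 - z), by simp [setT5], fun z hz => ?_⟩
    rw [H z hz]; push_cast; ring
  · refine ⟨fun z => z / (1 + z), by simp [setT5], fun z hz => ?_⟩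
    rw [H z hz]; push_cast; ring
  · refine ⟨fun z => z, by simp [setT5], fun z hz => ?_⟩
    rw [H z hz]; push_cast; ring
  all_goals
    have key : ∀ z ∈ unitDisk, 1 - z ≠ 0 ∧ 1 + z ≠ 0 ∧ 1 - z ^ 2 ≠ 0 := fun z hz =>
      ⟨one_sub_ne_zero hz, one_add_ne_zero hz, one_sub_sq_ne_zero hz⟩
  · refine ⟨fun z => z * (2 - z ^ 2) / (2 * (1 - z ^ 2)), by simp [setT5], fun z hz => ?_⟩
    obtain ⟨k1, k2, k3⟩ := key z hz
    rw [H z hz]; push_cast; field_simp; ring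
  · refine ⟨fun z => z / (1 - z ^ 2), by simp [setT5], fun z hz => ?_⟩
    obtain ⟨k1, k2, k3⟩ := key z hz
    rw [H z hz]; push_cast; field_simp; ring
  · refine ⟨fun z => z * (2 - z) / (2 * (1 - z)), by simp [setT5], fun z hz => ?_⟩
    obtain ⟨k1, k2, k3⟩ := key z hz
    rw [H z hz]; push_cast; field_simp; ring
  · refine ⟨fun z => z * (2 + z) / (2 * (1 + z)), by simp [setT5], fun z hz => ?_⟩
    obtain ⟨k1, k2, k3⟩ := key z hz
    rw [H z hz]; push_cast; field_simp; ring
  · refine ⟨fun z => z * (2 + z) / (2 * (1 - z ^ 2)), by simp [setT5], fun z hz => ?_⟩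
    obtain ⟨k1, k2, k3⟩ := key z hz
    rw [H z hz]; push_cast; field_simp; ring
  · refine ⟨fun z => z * (2 - z) / (2 * (1 - z ^ 2)), by simp [setT5], fun z hz => ?_⟩
    obtain ⟨k1, k2, k3⟩ := key z hz
    rw [H z hz]; push_cast; field_simp; ring

/-- The harmonic mapping with `h + g = z / (1 - ε z)` and `h - g = z / (1 - ε z) ^ 2`. -/
lemma add_conj_eq {h g : ℂ → ℂ} {ε : ℤ} (hF : h z + g z = z / (1 - ε * z))
    (hG : g z = -z / 2 * (ε * z / (1 - ε * z) ^ 2)) :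
    h z + (starRingEnd ℂ) (g z) =
      ((z / (1 - ε * z)).re : ℂ) + I * ((z / (1 - ε * z) ^ 2).im : ℂ) := by
  have h1 : h z - g z = z / (1 - ε * z) ^ 2 := by
    have : h z - g z = (h z + g z) - 2 * g z := by ring
    rw [this, hF, hG]
    field_simp
    ring
  rw [← h1, ← hF]
  apply Complex.ext <;> simp; ring

end ClosedForms

end UnivalentHarmonic

/-! ### The classification theorem -/

open UnivalentHarmonic in
theorem theorem4 (f : ℂ → ℂ)
    (hf : f ∈ UnivalentHarmonic.classSH0)
    (hcoeff : UnivalentHarmonic.HasHalfIntegerCoefficients f)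
    (hconv : UnivalentHarmonic.IsConvexInImaginaryDirection f) :
    ∃ F ∈ UnivalentHarmonic.setT5 ∪ UnivalentHarmonic.setT6,
      Set.EqOn f F UnivalentHarmonic.unitDisk := by
  obtain ⟨⟨-, hinj, h, g, hdec, hh0, hh1, hpos⟩, h₂, g₂, hdec₂, hg₂⟩ := hf
  obtain ⟨h₃, g₃, hdec₃, hhalf⟩ := hcoeff
  -- The hypotheses supply separate decompositions of f; uniqueness transfers their coefficient data
  -- to the single pair h, g.
  have hcoef : ∀ n, IsHalfInteger (taylorCoeff h n) ∧ IsHalfInteger (taylorCoeff g n) := fun n => by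
    rw [taylorCoeff_congr (hdec.eqOn hdec₃).1, taylorCoeff_congr (hdec.eqOn hdec₃).2]
    exact hhalf n
  have hg1 : deriv g 0 = 0 := by
    rw [← taylorCoeff_one, taylorCoeff_congr (hdec.eqOn hdec₂).2, taylorCoeff_one]
    simpa using hg₂
  have hh := hdec.analytic_h
  have hg := hdec.analytic_g
  choose a ha using fun n => (hcoef n).1
  choose b hb using fun n => (hcoef n).2
  have hint : ∀ m k : ℤ, (k : ℂ) / 2 = m / 2 → k = m := fun m k hmk => by
    have : (k : ℂ) = m := by linear_combination 2 * hmk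
    exact_mod_cast this
  have ha0 : a 0 = 0 := hint _ _ (by rw [← ha, taylorCoeff_zero, hh0]; simp)
  have ha1 : a 1 = 2 := hint _ _ (by rw [← ha, taylorCoeff_one, hh1]; simp)
  have hb0 : b 0 = 0 := hint _ _ (by rw [← hb, taylorCoeff_zero, hdec.g_zero]; simp)
  have hb1 : b 1 = 0 := hint _ _ (by rw [← hb, taylorCoeff_one, hg1]; simp)
  have hfE : Set.EqOn f (fun z => h z + (starRingEnd ℂ) (g z)) unitDisk := hdec.eq_add_conj
  have hconv' : IsConvexInImaginaryDirection fun z => h z + (starRingEnd ℂ) (g z) := by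
    unfold IsConvexInImaginaryDirection at hconv ⊢
    rwa [← Set.image_congr hfE]
  obtain ⟨hFinj, hFconv⟩ := shear hh hg (hinj.congr hfE) hpos hconv'
  have hFd : DifferentiableOn ℂ (fun z => h z + g z) unitDisk := hh.add hg
  have hFc : ∀ n, taylorCoeff (fun z => h z + g z) n = ((a n + b n : ℤ) : ℂ) / 2 := fun n => by
    rw [taylorCoeff_add hh hg, ha, hb]; push_cast; ring
  have hderiv : ∀ z ∈ unitDisk, deriv (fun z => h z + g z) z = deriv h z + deriv g z :=
    fun z hz => deriv_fun_add (hh.differentiableAt (isOpen_unitDisk.mem_nhds hz))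
      (hg.differentiableAt (isOpen_unitDisk.mem_nhds hz))
  have hF : IsRealVerticallyConvex fun z => h z + g z :=
    { differentiableOn := hFd
      injOn := hFinj
      deriv_ne_zero := fun z hz h0 => by
        rw [hderiv z hz] at h0
        have := hpos z hz
        rw [eq_neg_of_add_eq_zero_left h0, norm_neg] at this
        simp at this
      map_zero := by simp [hh0, hdec.g_zero]
      deriv_zero := by rw [hderiv 0 zero_mem_unitDisk, hh1, hg1, add_zero]
      map_conj := fun z hz => map_conj_of_real_taylorCoeff hFd
        (c := fun n => ((a n + b n : ℤ) : ℝ) / 2) (fun n => by rw [hFc]; push_cast; rfl) hz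
      convex := hFconv }
  obtain ⟨t, ht⟩ := hF.exists_isAdmissible (α := fun n => a n + b n) hFc
  obtain ⟨s, hs⟩ := exists_isShearPair hh hg hpos ha hb ha1 hb1
  have hharm : ∀ ε : ℤ, (ε = 1 ∨ ε = -1) →
      (∀ n : ℕ, a (n + 1) + b (n + 1) = 2 * ε ^ n ∧ b (n + 1) = -n * ε ^ n) →
      ∀ z ∈ unitDisk, f z = ((z / (1 - ε * z)).re : ℂ) +
        Complex.I * ((z / (1 - ε * z) ^ 2).im : ℂ) := by
    intro ε hε hab z hz
    rw [hdec.eq_add_conj z hz]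
    refine add_conj_eq ?_ ?_
    · exact eq_of_geometric_coeff hFd hε hFc (by simp [ha0, hb0]) (fun n => (hab n).1) hz
    · exact eq_of_arithmetic_geometric_coeff hg hε hb hb0 (fun n => (hab n).2) hz
  rcases hs.classified ht with ⟨hcl, hb2⟩ | hB | hB
  · have hgz : ∀ z ∈ unitDisk, g z = 0 := fun z hz => eq_zero_of_coeff hg (fun n => by
      rw [hb]
      rcases n with _ | _ | n
      · simp [hb0]
      · simp [hb1]
      · simp [hb2 n]) hz
    obtain ⟨F, hF5, hFE⟩ := exists_mem_setT5 hFd hFc (by simp [ha0, hb0]) (by simp [ha1, hb1]) hcl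
    refine ⟨F, Or.inl hF5, fun z hz => ?_⟩
    rw [← hFE hz, hdec.eq_add_conj z hz]
    simp [hgz z hz]
  · refine ⟨_, Or.inr (Or.inl rfl), fun z hz => ?_⟩
    have := hharm 1 (Or.inl rfl) (fun n => by simpa using hB n) z hz
    simpa using this
  · refine ⟨_, Or.inr (Or.inr rfl), fun z hz => ?_⟩
    have := hharm (-1) (Or.inr rfl) hB z hz
    simpa using this
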